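/- An assignment problem consists of agents $1,\dots,n$, objects $o_1,\dots,o_m$, and, for each agent $i$, a complete and transitive relation $\succsim_i$ on the objects (so indifferences are allowed). A discrete assignment is a matrix $p=(p(i)(o))$ with entries in $\{0,1\}$ such that $\sum_{i=1}^n p(i)(o)=1$ for every object $o$. For vectors $x,y\in\mathbb R^m$ indexed by the objects, write $x\succsim_i^{SD}y$ if $\sum_{o'\succsim_i o}x(o')\ge\sum_{o'\succsim_i o}y(o')$ for every object $o$, and $x\succ_i^{SD}y$ if $x\succsim_i^{SD}y$ and not $y\succsim_i^{SD}x$. The assignment $p$ is weak SD proportional if there is no agent $i$ with $(1/n,\dots,1/n)\succ_i^{SD}p(i)$. Theorem. For a constant number of agents, it can be decided in polynomial time whether a weak SD proportional discrete assignment exists. Precisely, there is a single algorithm that, given any assignment problem, decides whether it has a weak SD proportional discrete assignment, and for every fixed $n$ its running time on the problems with $n$ agents is bounded by a polynomial in the size of the input. Here an algorithm is a program for the uniform-cost random access machine with addition and truncated subtraction (without multiplication), and the input is a binary word that lists $n$ and $m$ in unary and the truth values of all comparisons $o\succsim_i o'$. -/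

import Mathlib

/-! ## Assignment problems and weak SD proportionality -/

/-- An assignment problem with agents `Fin n` and objects `Fin m`: each agent has a complete and
transitive preference relation over the objects, so indifferences are allowed.
`pref i a b` means that agent `i` finds `a` at least as good as `b`. -/
structure AssignmentProblem (n m : ℕ) where
  pref : Fin n → Fin m → Fin m → Prop
  complete : ∀ i a b, pref i a b ∨ pref i b a
  trans : ∀ i a b c, pref i a b → pref i b c → pref i a c

/-- A fractional assignment: an `n × m` matrix with entries in `[0,1]`, each column of which sums
to `1` (every object is completely allocated). -/
def IsFractionalAssignment {n m : ℕ} (p : Fin n → Fin m → ℝ) : Prop :=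
  (∀ i o, 0 ≤ p i o ∧ p i o ≤ 1) ∧ ∀ o, ∑ i, p i o = 1

/-- A discrete assignment: a fractional assignment all of whose entries are `0` or `1`. -/
def IsDiscreteAssignment {n m : ℕ} (p : Fin n → Fin m → ℝ) : Prop :=
  IsFractionalAssignment p ∧ ∀ i o, p i o = 0 ∨ p i o = 1

namespace AssignmentProblem

variable {n m : ℕ}

open Classical in
/-- Agent `i` SD prefers the allocation `x` to the allocation `y`: for every object `o`, the
total amount in `x` of the objects at least as good as `o` is at least that in `y`. -/
def SDPrefers (A : AssignmentProblem n m) (i : Fin n) (x y : Fin m → ℝ) : Prop :=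
  ∀ o : Fin m, ∑ o' with A.pref i o' o, y o' ≤ ∑ o' with A.pref i o' o, x o'

/-- Agent `i` strictly SD prefers `x` to `y`. -/
def StrictlySDPrefers (A : AssignmentProblem n m) (i : Fin n) (x y : Fin m → ℝ) : Prop :=
  A.SDPrefers i x y ∧ ¬ A.SDPrefers i y x

/-- `p` is weak SD proportional: no agent strictly SD prefers `(1/n, …, 1/n)` to the allocation
that `p` gives to the agent. -/
def WeakSDProportional (A : AssignmentProblem n m) (p : Fin n → Fin m → ℝ) : Prop :=
  ∀ i, ¬ A.StrictlySDPrefers i (fun _ => 1 / (n : ℝ)) (p i)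

/-- The question to be decided. -/
def HasWeakSDProportionalDiscreteAssignment (A : AssignmentProblem n m) : Prop :=
  ∃ p : Fin n → Fin m → ℝ, IsDiscreteAssignment p ∧ A.WeakSDProportional p

open Classical in
/-- An assignment problem as a binary word: `n` and `m` in unary, each followed by a `false`,
then for all `i`, `a`, `b`, in lexicographic order, the bit that tells whether agent `i` finds
`a` at least as good as `b`. The length is `n + m + 2 + n * m ^ 2`. -/
noncomputable def encode (A : AssignmentProblem n m) : List Bool :=
  List.replicate n true ++ false :: (List.replicate m true ++ false ::
    (List.finRange n).flatMap fun i => (List.finRange m).flatMap fun a =>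
      (List.finRange m).map fun b => decide (A.pref i a b))

end AssignmentProblem

/-! ## Random access machines

Structured programs for the uniform-cost random access machine with addition and truncated
subtraction (and no multiplication). Polynomial time on this machine is the usual polynomial
time. -/

namespace RAM

/-- A state: the values of the scalar registers, and the contents of the arrays. A program
mentions only finitely many registers and arrays; the cells of an array are addressed by natural
numbers. -/
structure State where
  reg : ℕ → ℕ
  arr : ℕ → ℕ → ℕ

/-- Arithmetic expressions. -/
inductive Exp where
  /-- a constant -/
  | lit (c : ℕ)
  /-- the value of register `x` -/
  | reg (x : ℕ)
  /-- the cell of array `a` whose address is the value of `e` (indirect addressing) -/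
  | get (a : ℕ) (e : Exp)
  /-- addition -/
  | add (e₁ e₂ : Exp)
  /-- truncated subtraction -/
  | sub (e₁ e₂ : Exp)

/-- The value of an expression. -/
def Exp.eval (s : State) : Exp → ℕ
  | lit c => c
  | reg x => s.reg x
  | get a e => s.arr a (e.eval s)
  | add e₁ e₂ => e₁.eval s + e₂.eval s
  | sub e₁ e₂ => e₁.eval s - e₂.eval s

/-- The number of steps that the evaluation of an expression takes: one for each operation,
memory access or constant in it. -/
def Exp.cost : Exp → ℕ
  | lit _ => 1
  | reg _ => 1
  | get _ e => e.cost + 1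
  | add e₁ e₂ => e₁.cost + e₂.cost + 1
  | sub e₁ e₂ => e₁.cost + e₂.cost + 1

/-- Programs. -/
inductive Prog where
  /-- do nothing -/
  | nop
  /-- register `x` := value of `e` -/
  | assign (x : ℕ) (e : Exp)
  /-- cell of array `a` with address `e₁` := value of `e₂` -/
  | store (a : ℕ) (e₁ e₂ : Exp)
  /-- first `c₁`, then `c₂` -/
  | seq (c₁ c₂ : Prog)
  /-- if `e ≠ 0` then `c₁`, otherwise `c₂` -/
  | branch (e : Exp) (c₁ c₂ : Prog)
  /-- while `e ≠ 0`, repeat `c` -/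
  | loop (e : Exp) (c : Prog)

/-- `Exec c s t s'`: the program `c`, started in the state `s`, halts after exactly `t` steps in
the state `s'`. -/
inductive Exec : Prog → State → ℕ → State → Prop where
  | nop (s : State) : Exec .nop s 1 s
  | assign (x : ℕ) (e : Exp) (s : State) :
      Exec (.assign x e) s (e.cost + 1) { s with reg := Function.update s.reg x (e.eval s) }
  | store (a : ℕ) (e₁ e₂ : Exp) (s : State) :
      Exec (.store a e₁ e₂) s (e₁.cost + e₂.cost + 1)
        { s with
          arr := Function.update s.arr a
            (Function.update (s.arr a) (e₁.eval s) (e₂.eval s)) }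
  | seq (c₁ c₂ : Prog) (s s' s'' : State) (t₁ t₂ : ℕ) :
      Exec c₁ s t₁ s' → Exec c₂ s' t₂ s'' → Exec (.seq c₁ c₂) s (t₁ + t₂) s''
  | branch_true (e : Exp) (c₁ c₂ : Prog) (s s' : State) (t : ℕ) :
      e.eval s ≠ 0 → Exec c₁ s t s' → Exec (.branch e c₁ c₂) s (e.cost + 1 + t) s'
  | branch_false (e : Exp) (c₁ c₂ : Prog) (s s' : State) (t : ℕ) :
      e.eval s = 0 → Exec c₂ s t s' → Exec (.branch e c₁ c₂) s (e.cost + 1 + t) s'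
  | loop_true (e : Exp) (c : Prog) (s s' s'' : State) (t₁ t₂ : ℕ) :
      e.eval s ≠ 0 → Exec c s t₁ s' → Exec (.loop e c) s' t₂ s'' →
        Exec (.loop e c) s (e.cost + 1 + t₁ + t₂) s''
  | loop_false (e : Exp) (c : Prog) (s : State) :
      e.eval s = 0 → Exec (.loop e c) s (e.cost + 1) s

/-- The initial state on the input word `w`: register `0` holds the length of `w`, array `0`
holds its bits, and everything else is `0`. -/
def init (w : List Bool) : State where
  reg := fun x => if x = 0 then w.length else 0
  arr := fun a k => if a = 0 ∧ w[k]? = some true then 1 else 0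

/-- On the input word `w`, the program `c` halts within `T` steps, with `1` in register `0` if
`answer` is true and with `0` in register `0` if `answer` is false. -/
def Prog.AnswersWithin (c : Prog) (w : List Bool) (answer : Prop) (T : ℕ) : Prop :=
  ∃ (t : ℕ) (s : State), t ≤ T ∧ Exec c (init w) t s ∧
    (answer → s.reg 0 = 1) ∧ (¬ answer → s.reg 0 = 0)

end RAM

/-! An agent `i` is content with a discrete assignment if and only if one of two things holds:
for some object `o`, the agent gets more than the fraction `1 / n` of the objects at least as good
as `o`; or, for every object, the agent gets at least this fraction. If the first case is excluded,
then the second one holds with equality, and so it says that the agent gets the fraction `1 / n` of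
every indifference class. So one may guess, for every agent, either an object `g i < m`, or
`g i = m` for the second case; this makes `(m + 1) ^ n` guesses, polynomially many for fixed `n`
(`AssignmentProblem.hasWeakSDProportionalDiscreteAssignment_iff`).

A guess turns the question into one about bipartite matchings: every agent demands a certain number
of objects out of each of certain groups of objects, where the groups of one agent are disjoint. As
demands are lower bounds, objects that nobody demands do not matter. It is decided by an auction.
All objects are free and unowned at first. As long as the demand of an agent on a group is not met,
the agent takes a cheapest object of the group, if its price is at most `m`, and the price goes up
by `1`. The sum of the prices bounds the number of bids. If the auction ends with an unmet demand,
then some price does not occur, and the objects dearer than that violate Hall's condition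
(`Auction.Invariant.not_satisfies`).

For the running time, the algorithm is written in a language with bounded sums and counting loops
only (`RAM.BExp`, `RAM.BProg`). The bounds of the sums and loops are registers that the program does
not change, so that its running time is a polynomial in the largest of them (`RAM.BProg.time`), and
`RAM.BProg.exec_compile` translates such programs to the random access machine. There are three
stages. The first reads `n` and `m` off the input, the second computes the bounds that the third
needs, and the third goes through all guesses. -/

/-! ### Bounded programs and their compilation -/

namespace RAM

/-- The state `s` with `v` in register `x`. -/
def State.setReg (s : State) (x v : ℕ) : State :=
  { s with reg := Function.update s.reg x v }

/-- The state `s` with `v` in the cell of array `a` with address `k`. -/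
def State.setArr (s : State) (a k v : ℕ) : State :=
  { s with arr := Function.update s.arr a (Function.update (s.arr a) k v) }

@[simp] lemma State.setReg_arr (s : State) (x v : ℕ) : (s.setReg x v).arr = s.arr := rfl

@[simp] lemma State.setArr_reg (s : State) (a k v : ℕ) : (s.setArr a k v).reg = s.reg := rfl

@[simp] lemma State.setReg_reg (s : State) (x v y : ℕ) :
    (s.setReg x v).reg y = if y = x then v else s.reg y := by
  simp [State.setReg, Function.update_apply]

@[simp] lemma State.setArr_arr (s : State) (a k v b l : ℕ) :
    (s.setArr a k v).arr b l = if b = a ∧ l = k then v else s.arr b l := by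
  by_cases hb : b = a
  · subst hb
    simp [State.setArr, Function.update_apply]
  · simp [State.setArr, hb]

lemma State.setArr_arr_of_ne (s : State) (a k v : ℕ) {b : ℕ} (h : b ≠ a) :
    (s.setArr a k v).arr b = s.arr b := by
  simp [State.setArr, h]

/-- The states `s` and `s'` have the same arrays and the same registers below `D`. -/
def AgreeBelow (D : ℕ) (s s' : State) : Prop :=
  (∀ x < D, s.reg x = s'.reg x) ∧ s.arr = s'.arr

lemma AgreeBelow.setReg {D : ℕ} {s s' : State} (h : AgreeBelow D s s') (x v : ℕ) :
    AgreeBelow D (s.setReg x v) (s'.setReg x v) := by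
  refine ⟨fun y hy => ?_, h.2⟩
  simp [h.1 y hy]

/-- Arithmetic expressions with bounded sums. -/
inductive BExp where
  /-- a constant -/
  | lit (c : ℕ)
  /-- the value of register `x` -/
  | reg (x : ℕ)
  /-- the cell of array `a` whose address is the value of `e` -/
  | get (a : ℕ) (e : BExp)
  /-- addition -/
  | add (e₁ e₂ : BExp)
  /-- truncated subtraction -/
  | sub (e₁ e₂ : BExp)
  /-- the sum of the values of `e` as register `x` runs over the numbers less than the value of
  register `r` -/
  | sum (x r : ℕ) (e : BExp)

namespace BExp

/-- The value of an expression. The summation variable is bound: it is set for the evaluation of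
the summand only. -/
def eval (s : State) : BExp → ℕ
  | lit c => c
  | reg x => s.reg x
  | get a e => s.arr a (e.eval s)
  | add e₁ e₂ => e₁.eval s + e₂.eval s
  | sub e₁ e₂ => e₁.eval s - e₂.eval s
  | sum x r e => ∑ j ∈ Finset.range (s.reg r), e.eval (s.setReg x j)

/-- All registers of the expression are less than `D`, and the registers that bound its sums are
less than `K`, whereas the summation variables are not. -/
def Scoped (K D : ℕ) : BExp → Prop
  | lit _ => True
  | reg x => x < D
  | get _ e => e.Scoped K D
  | add e₁ e₂ => e₁.Scoped K D ∧ e₂.Scoped K D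
  | sub e₁ e₂ => e₁.Scoped K D ∧ e₂.Scoped K D
  | sum x r e => K ≤ x ∧ x < D ∧ r < K ∧ e.Scoped K D

/-- A program that puts the value of the expression into register `d`. It uses the registers from
`d` on as scratch space and restores all others. -/
def compile : BExp → ℕ → Prog
  | lit c, d => .assign d (.lit c)
  | reg x, d => .assign d (.reg x)
  | get a e, d => .seq (e.compile d) (.assign d (.get a (.reg d)))
  | add e₁ e₂, d =>
      .seq (e₁.compile d) (.seq (e₂.compile (d + 1)) (.assign d (.add (.reg d) (.reg (d + 1)))))
  | sub e₁ e₂, d =>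
      .seq (e₁.compile d) (.seq (e₂.compile (d + 1)) (.assign d (.sub (.reg d) (.reg (d + 1)))))
  | sum x r e, d =>
      .seq (.assign d (.reg x)) <| .seq (.assign (d + 1) (.lit 0)) <| .seq (.assign x (.lit 0)) <|
      .seq (.loop (.sub (.reg r) (.reg x))
        (.seq (e.compile (d + 2))
          (.seq (.assign (d + 1) (.add (.reg (d + 1)) (.reg (d + 2))))
            (.assign x (.add (.reg x) (.lit 1)))))) <|
      .seq (.assign x (.reg d)) (.assign d (.reg (d + 1)))

/-- A bound on the running time of the compiled expression, in terms of a bound on the registers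
that bound the sums. -/
noncomputable def time : BExp → Polynomial ℕ
  | lit _ => 2
  | reg _ => 2
  | get _ e => e.time + 3
  | add e₁ e₂ => e₁.time + e₂.time + 4
  | sub e₁ e₂ => e₁.time + e₂.time + 4
  | sum _ _ e => Polynomial.X * (e.time + 12) + 14

lemma eval_add (s : State) (e₁ e₂ : BExp) : (add e₁ e₂).eval s = e₁.eval s + e₂.eval s := rfl

lemma eval_sum (s : State) (x r : ℕ) (e : BExp) :
    (sum x r e).eval s = ∑ j ∈ Finset.range (s.reg r), e.eval (s.setReg x j) := rfl

lemma eval_congr {K D : ℕ} {e : BExp} (he : e.Scoped K D) {s s' : State}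
    (h : AgreeBelow D s s') : e.eval s = e.eval s' := by
  induction e generalizing s s' with
  | lit c => rfl
  | reg x => exact h.1 x he
  | get a e ih => simp only [eval, ih he h, h.2]
  | add e₁ e₂ ih₁ ih₂ => simp only [eval, ih₁ he.1 h, ih₂ he.2 h]
  | sub e₁ e₂ ih₁ ih₂ => simp only [eval, ih₁ he.1 h, ih₂ he.2 h]
  | sum x r e ih =>
    obtain ⟨h1, h2, h3, h4⟩ := he
    simp only [eval, h.1 r (by omega)]
    exact Finset.sum_congr rfl fun j _ => ih h4 (h.setReg x j)

end BExp

lemma Exec.assign' (x : ℕ) (e : Exp) (s : State) :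
    Exec (.assign x e) s (e.cost + 1) (s.setReg x (e.eval s)) :=
  Exec.assign x e s

lemma Exec.andThen {c₁ c₂ : Prog} {s s' s'' : State} {t₁ t₂ : ℕ} (h₁ : Exec c₁ s t₁ s')
    (h₂ : Exec c₂ s' t₂ s'') : Exec (.seq c₁ c₂) s (t₁ + t₂) s'' :=
  Exec.seq _ _ _ _ _ _ _ h₁ h₂

/-- A counting loop whose body takes at most `T` steps and maintains the invariant `I`. -/
lemma Exec.loop_of_invariant {x r R T : ℕ} {c : Prog} (I : ℕ → State → Prop)
    (hx : ∀ j s, I j s → s.reg x = j ∧ s.reg r = R)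
    (hc : ∀ j s, j < R → I j s → ∃ t s', t ≤ T ∧ Exec c s t s' ∧ I (j + 1) s')
    {s : State} (hs : I 0 s) :
    ∃ t s', t ≤ R * (T + 4) + 4 ∧ Exec (.loop (.sub (.reg r) (.reg x)) c) s t s' ∧ I R s' := by
  suffices H : ∀ k j s, j + k = R → I j s →
      ∃ t s', t ≤ k * (T + 4) + 4 ∧ Exec (.loop (.sub (.reg r) (.reg x)) c) s t s' ∧ I R s' from
    H R 0 s (by omega) hs
  intro k
  induction k with
  | zero =>
    intro j s hj hI
    obtain rfl : j = R := by omega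
    refine ⟨_, s, ?_, Exec.loop_false _ _ _ ?_, hI⟩
    · simp [Exp.cost]
    · simp [Exp.eval, hx j s hI]
  | succ k ih =>
    intro j s hj hI
    obtain ⟨t₁, s₁, ht₁, hE₁, hI₁⟩ := hc j s (by omega) hI
    obtain ⟨t₂, s₂, ht₂, hE₂, hI₂⟩ := ih (j + 1) s₁ (by omega) hI₁
    refine ⟨_, s₂, ?_, Exec.loop_true _ _ _ _ _ _ _ ?_ hE₁ hE₂, hI₂⟩
    · simp only [Exp.cost]
      linarith
    · simp only [Exp.eval, hx j s hI]
      omega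

/-- The compiled expression computes the value of the expression within the stated time. -/
theorem BExp.exec_compile {K D B : ℕ} (hK : K ≤ D) {e : BExp} (he : e.Scoped K D)
    {d : ℕ} (hd : D ≤ d)
    {s : State} (hB : ∀ r < K, s.reg r ≤ B) :
    ∃ t s', t ≤ e.time.eval B ∧ Exec (e.compile d) s t s' ∧ AgreeBelow d s' s ∧
      s'.reg d = e.eval s := by
  induction e generalizing d s with
  | lit c =>
    refine ⟨_, _, ?_, Exec.assign' _ _ _, ⟨fun x hx => ?_, rfl⟩, ?_⟩
    · simp [Exp.cost, time]
    · simp [hx.ne]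
    · simp [Exp.eval, eval]
  | reg y =>
    refine ⟨_, _, ?_, Exec.assign' _ _ _, ⟨fun x hx => ?_, rfl⟩, ?_⟩
    · simp [Exp.cost, time]
    · simp [hx.ne]
    · simp [Exp.eval, eval]
  | get a e ih =>
    obtain ⟨t, s', ht, hE, hA, hv⟩ := ih he hd hB
    refine ⟨_, _, ?_, Exec.andThen hE (Exec.assign' _ _ _), ⟨fun x hx => ?_, hA.2⟩, ?_⟩
    · simpa [Exp.cost, time] using ht
    · simp [hx.ne, hA.1 x hx]
    · simp [Exp.eval, eval, hv, hA.2]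
  | add e₁ e₂ ih₁ ih₂ =>
    obtain ⟨t₁, s₁, ht₁, hE₁, hA₁, hv₁⟩ := ih₁ he.1 hd hB
    obtain ⟨t₂, s₂, ht₂, hE₂, hA₂, hv₂⟩ := ih₂ he.2 (d := d + 1) (s := s₁) (by omega)
      (fun r hr => by rw [hA₁.1 r (by omega)]; exact hB r hr)
    have hev : e₂.eval s₁ = e₂.eval s :=
      eval_congr he.2 ⟨fun x hx => hA₁.1 x (by omega), hA₁.2⟩
    refine ⟨_, _, ?_, Exec.andThen hE₁ (Exec.andThen hE₂
      (Exec.assign' _ _ _)), ⟨fun x hx => ?_, hA₂.2.trans hA₁.2⟩, ?_⟩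
    · simp only [Exp.cost, time, Polynomial.eval_add, Polynomial.eval_ofNat]
      omega
    · simp [hx.ne, hA₁.1 x hx, hA₂.1 x (by omega)]
    · simp [Exp.eval, eval, hv₁, hv₂, hev, hA₂.1 d (by omega)]
  | sub e₁ e₂ ih₁ ih₂ =>
    obtain ⟨t₁, s₁, ht₁, hE₁, hA₁, hv₁⟩ := ih₁ he.1 hd hB
    obtain ⟨t₂, s₂, ht₂, hE₂, hA₂, hv₂⟩ := ih₂ he.2 (d := d + 1) (s := s₁) (by omega)
      (fun r hr => by rw [hA₁.1 r (by omega)]; exact hB r hr)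
    have hev : e₂.eval s₁ = e₂.eval s :=
      eval_congr he.2 ⟨fun x hx => hA₁.1 x (by omega), hA₁.2⟩
    refine ⟨_, _, ?_, Exec.andThen hE₁ (Exec.andThen hE₂
      (Exec.assign' _ _ _)), ⟨fun x hx => ?_, hA₂.2.trans hA₁.2⟩, ?_⟩
    · simp only [Exp.cost, time, Polynomial.eval_add, Polynomial.eval_ofNat]
      omega
    · simp [hx.ne, hA₁.1 x hx, hA₂.1 x (by omega)]
    · simp [Exp.eval, eval, hv₁, hv₂, hev, hA₂.1 d (by omega)]
  | sum x r e ih =>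
    obtain ⟨h1, h2, h3, h4⟩ := he
    set R := s.reg r with hR
    let I : ℕ → State → Prop := fun j σ => σ.arr = s.arr ∧ σ.reg x = j ∧ σ.reg d = s.reg x ∧
      σ.reg (d + 1) = ∑ i ∈ Finset.range j, e.eval (s.setReg x i) ∧
      ∀ y < d, y ≠ x → σ.reg y = s.reg y
    have hI : I 0 (((s.setReg d (s.reg x)).setReg (d + 1) 0).setReg x 0) := by
      refine ⟨rfl, by simp, ?_, ?_, fun y hy hyx => ?_⟩
      · simp [show d ≠ x by omega]
      · simp [show d + 1 ≠ x by omega]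
      · simp [hyx, hy.ne, show y ≠ d + 1 by omega]
    obtain ⟨t, σ, ht, hE, hσ⟩ := Exec.loop_of_invariant (x := x) (r := r) (R := R)
      (T := e.time.eval B + 8)
      (c := .seq (e.compile (d + 2))
          (.seq (.assign (d + 1) (.add (.reg (d + 1)) (.reg (d + 2))))
            (.assign x (.add (.reg x) (.lit 1))))) I
      (fun j s h => ⟨h.2.1, h.2.2.2.2 r (by omega) (by omega)⟩) (fun j σ hj hσ => by
        obtain ⟨g1, g2, g3, g4, g5⟩ := hσ
        obtain ⟨t, σ', ht, hE, hA, hv⟩ := ih h4 (d := d + 2) (s := σ) (by omega)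
          (fun r' hr' => by rw [g5 r' (by omega) (by omega)]; exact hB r' hr')
        have hev : e.eval σ = e.eval (s.setReg x j) := by
          refine eval_congr h4 ⟨fun y hy => ?_, g1⟩
          by_cases hyx : y = x
          · simp [hyx, g2]
          · simp [hyx, g5 y (by omega) hyx]
        refine ⟨_, _, ?_, Exec.andThen hE (Exec.andThen
          (Exec.assign' _ _ _) (Exec.assign' _ _ _)), ?_, ?_, ?_, ?_, ?_⟩
        · simp only [Exp.cost]
          omega
        · exact hA.2.trans g1
        · simp [Exp.eval, show x ≠ d + 1 by omega, hA.1 x (by omega), g2]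
        · simp [Exp.eval, show d ≠ x by omega, hA.1 d (by omega), g3]
        · simp [Exp.eval, show d + 1 ≠ x by omega, hA.1 (d + 1) (by omega), g4, hv, hev,
            Finset.sum_range_succ]
        · intro y hy hyx
          simp [Exp.eval, hyx, show y ≠ d + 1 by omega, hA.1 y (by omega), g5 y hy hyx]) hI
    obtain ⟨g1, g2, g3, g4, g5⟩ := hσ
    refine ⟨_, _, ?_, Exec.andThen (Exec.assign' _ _ _) (Exec.andThen (Exec.assign' _ _ _)
      (Exec.andThen (Exec.assign' _ _ _) (Exec.andThen hE (Exec.andThen (Exec.assign' _ _ _)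
      (Exec.assign' _ _ _))))), ⟨fun y hy => ?_, ?_⟩, ?_⟩
    · -- the summand, and `12` further steps in each round
      have hRB : R * (e.time.eval B + 8 + 4) ≤ B * (e.time.eval B + 12) :=
        Nat.mul_le_mul_right _ (hB r h3)
      simp only [Exp.cost, time, Polynomial.eval_add, Polynomial.eval_ofNat, Polynomial.eval_mul,
        Polynomial.eval_X]
      omega
    · by_cases hyx : y = x
      · simp [Exp.eval, hyx, show x ≠ d by omega, g3]
      · simp [Exp.eval, hyx, hy.ne, g5 y hy hyx]
    · exact g1
    · simp [Exp.eval, show d + 1 ≠ x by omega, g4, eval, hR]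

/-- Programs all of whose loops are counting loops. -/
inductive BProg where
  /-- do nothing -/
  | nop
  /-- register `x` := value of `e` -/
  | assign (x : ℕ) (e : BExp)
  /-- cell of array `a` with address `e₁` := value of `e₂` -/
  | store (a : ℕ) (e₁ e₂ : BExp)
  /-- first `c₁`, then `c₂` -/
  | seq (c₁ c₂ : BProg)
  /-- if `e ≠ 0` then `c₁`, otherwise `c₂` -/
  | branch (e : BExp) (c₁ c₂ : BProg)
  /-- execute `c` with register `x` set to `0`, then to `1`, and so on up to the value of
  register `r` (exclusive) -/
  | loop (x r : ℕ) (c : BProg)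

namespace BProg

/-- The state in which a program ends. All bounded programs halt, so this is a function. -/
def run : BProg → State → State
  | nop, s => s
  | assign x e, s => s.setReg x (e.eval s)
  | store a e₁ e₂, s => s.setArr a (e₁.eval s) (e₂.eval s)
  | seq c₁ c₂, s => c₂.run (c₁.run s)
  | branch e c₁ c₂, s => if e.eval s ≠ 0 then c₁.run s else c₂.run s
  | loop x r c, s => Nat.rec s (fun j s' => c.run (s'.setReg x j)) (s.reg r)

/-- All registers of the program are less than `D`, and the registers that bound its loops and
sums are less than `K`. The registers less than `K` are not written to, so that all those bounds
are constant during an execution. -/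
def Scoped (K D : ℕ) : BProg → Prop
  | nop => True
  | assign x e => K ≤ x ∧ x < D ∧ e.Scoped K D
  | store _ e₁ e₂ => e₁.Scoped K D ∧ e₂.Scoped K D
  | seq c₁ c₂ => c₁.Scoped K D ∧ c₂.Scoped K D
  | branch e c₁ c₂ => e.Scoped K D ∧ c₁.Scoped K D ∧ c₂.Scoped K D
  | loop x r c => K ≤ x ∧ x < D ∧ r < K ∧ c.Scoped K D

/-- A machine program that does what the bounded program does, and uses the registers from `d` on
as scratch space. The counter of a loop is kept there too. -/
def compile : BProg → ℕ → Prog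
  | nop, _ => .nop
  | assign x e, d => .seq (e.compile d) (.assign x (.reg d))
  | store a e₁ e₂, d =>
      .seq (e₁.compile d) (.seq (e₂.compile (d + 1)) (.store a (.reg d) (.reg (d + 1))))
  | seq c₁ c₂, d => .seq (c₁.compile d) (c₂.compile d)
  | branch e c₁ c₂, d => .seq (e.compile d) (.branch (.reg d) (c₁.compile d) (c₂.compile d))
  | loop x r c, d =>
      .seq (.assign d (.lit 0)) <| .loop (.sub (.reg r) (.reg d)) <|
        .seq (.assign x (.reg d)) <| .seq (c.compile (d + 1)) <|
        .assign d (.add (.reg d) (.lit 1))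

/-- A bound on the running time of the compiled program, in terms of a bound on the registers
that bound the loops and sums. -/
noncomputable def time : BProg → Polynomial ℕ
  | nop => 1
  | assign _ e => e.time + 2
  | store _ e₁ e₂ => e₁.time + e₂.time + 3
  | seq c₁ c₂ => c₁.time + c₂.time
  | branch e c₁ c₂ => e.time + c₁.time + c₂.time + 2
  | loop _ _ c => Polynomial.X * (c.time + 10) + 6

lemma run_loop_induction {x r : ℕ} {c : BProg} (I : ℕ → State → Prop) {s : State} (h0 : I 0 s)
    (hs : ∀ j s', j < s.reg r → I j s' → I (j + 1) (c.run (s'.setReg x j))) :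
    I (s.reg r) ((loop x r c).run s) := by
  suffices H : ∀ k ≤ s.reg r,
      I k (Nat.rec s (fun j s' => c.run (s'.setReg x j)) k) from H _ le_rfl
  intro k
  induction k with
  | zero => exact fun _ => h0
  | succ k ih => exact fun hk => hs k _ hk (ih (by omega))

/-- The registers below `K` keep their values. -/
lemma run_reg_lt {K D : ℕ} {c : BProg} (hc : c.Scoped K D) (s : State) {y : ℕ} (hy : y < K) :
    (c.run s).reg y = s.reg y := by
  induction c generalizing s with
  | nop => rfl
  | assign x e => simp [run, show y ≠ x by have := hc.1; omega]
  | store a e₁ e₂ => simp [run]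
  | seq c₁ c₂ ih₁ ih₂ => simp [run, ih₁ hc.1, ih₂ hc.2]
  | branch e c₁ c₂ ih₁ ih₂ =>
    simp only [run]
    split_ifs
    · exact ih₁ hc.2.1 s
    · exact ih₂ hc.2.2 s
  | loop x r c ih =>
    refine run_loop_induction (fun _ s' => s'.reg y = s.reg y) rfl fun j s' _ h => ?_
    rw [ih hc.2.2.2, State.setReg_reg, if_neg (by have := hc.1; omega), h]

/-- Register `x` is the target of an assignment or the variable of a loop. -/
def Writes (x : ℕ) : BProg → Prop
  | nop => False
  | assign y _ => x = y
  | store _ _ _ => False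
  | seq c₁ c₂ => c₁.Writes x ∨ c₂.Writes x
  | branch _ c₁ c₂ => c₁.Writes x ∨ c₂.Writes x
  | loop y _ c => x = y ∨ c.Writes x

lemma run_reg_of_not_writes {x : ℕ} {c : BProg} (hc : ¬ c.Writes x) (s : State) :
    (c.run s).reg x = s.reg x := by
  induction c generalizing s with
  | nop => rfl
  | assign y e => simp [run, show x ≠ y from hc]
  | store a e₁ e₂ => simp [run]
  | seq c₁ c₂ ih₁ ih₂ =>
    obtain ⟨h1, h2⟩ := not_or.1 hc
    simp [run, ih₁ h1, ih₂ h2]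
  | branch e c₁ c₂ ih₁ ih₂ =>
    obtain ⟨h1, h2⟩ := not_or.1 hc
    simp only [run]
    split_ifs
    · exact ih₁ h1 s
    · exact ih₂ h2 s
  | loop y r c ih =>
    obtain ⟨h1, h2⟩ := not_or.1 hc
    refine run_loop_induction (fun _ s' => s'.reg x = s.reg x) rfl fun j s' _ h => ?_
    rw [ih h2, State.setReg_reg, if_neg h1, h]

/-- The program stores into array `a`. -/
def Stores (a : ℕ) : BProg → Prop
  | nop => False
  | assign _ _ => False
  | store b _ _ => a = b
  | seq c₁ c₂ => c₁.Stores a ∨ c₂.Stores a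
  | branch _ c₁ c₂ => c₁.Stores a ∨ c₂.Stores a
  | loop _ _ c => c.Stores a

lemma run_arr_of_not_stores {a : ℕ} {c : BProg} (hc : ¬ c.Stores a) (s : State) :
    (c.run s).arr a = s.arr a := by
  induction c generalizing s with
  | nop => rfl
  | assign y e => rfl
  | store b e₁ e₂ => exact s.setArr_arr_of_ne _ _ _ hc
  | seq c₁ c₂ ih₁ ih₂ =>
    obtain ⟨h1, h2⟩ := not_or.1 hc
    simp [run, ih₁ h1, ih₂ h2]
  | branch e c₁ c₂ ih₁ ih₂ =>
    obtain ⟨h1, h2⟩ := not_or.1 hc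
    simp only [run]
    split_ifs
    · exact ih₁ h1 s
    · exact ih₂ h2 s
  | loop y r c ih =>
    refine run_loop_induction (fun _ s' => s'.arr a = s.arr a) rfl fun j s' _ h => ?_
    rw [ih hc, State.setReg_arr, h]

/-- The compiled program does what the bounded program does, within the stated time. -/
theorem exec_compile {K D B : ℕ} (hK : K ≤ D) {c : BProg} (hc : c.Scoped K D) {d : ℕ}
    (hd : D ≤ d) {s σ : State} (hσ : AgreeBelow D σ s) (hB : ∀ r < K, s.reg r ≤ B) :
    ∃ t σ', t ≤ c.time.eval B ∧ Exec (c.compile d) σ t σ' ∧ AgreeBelow D σ' (c.run s) ∧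
      ∀ x < d, D ≤ x → σ'.reg x = σ.reg x := by
  induction c generalizing d s σ with
  | nop => exact ⟨_, _, by simp [time], Exec.nop _, hσ, fun _ _ _ => rfl⟩
  | assign x e =>
    obtain ⟨h1, h2, h3⟩ := hc
    obtain ⟨t, σ', ht, hE, hA, hv⟩ := BExp.exec_compile hK h3 hd (s := σ) (B := B)
      (fun r hr => by rw [hσ.1 r (by omega)]; exact hB r hr)
    refine ⟨_, _, ?_, Exec.andThen hE (Exec.assign' _ _ _), ⟨fun y hy => ?_, ?_⟩,
      fun y hy hy' => ?_⟩
    · simpa [Exp.cost, time] using ht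
    · simp only [Exp.eval, hv, run, State.setReg_reg, BExp.eval_congr h3 hσ,
        hA.1 y (by omega), hσ.1 y hy]
    · exact hA.2.trans hσ.2
    · simp [show y ≠ x by omega, hA.1 y hy]
  | store a e₁ e₂ =>
    obtain ⟨h1, h2⟩ := hc
    obtain ⟨t₁, σ₁, ht₁, hE₁, hA₁, hv₁⟩ := BExp.exec_compile hK h1 hd (s := σ) (B := B)
      (fun r hr => by rw [hσ.1 r (by omega)]; exact hB r hr)
    obtain ⟨t₂, σ₂, ht₂, hE₂, hA₂, hv₂⟩ := BExp.exec_compile hK h2 (d := d + 1) (by omega)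
      (s := σ₁) (B := B)
      (fun r hr => by rw [hA₁.1 r (by omega), hσ.1 r (by omega)]; exact hB r hr)
    have hev : e₂.eval σ₁ = e₂.eval s :=
      BExp.eval_congr h2 ⟨fun x hx => (hA₁.1 x (by omega)).trans (hσ.1 x hx), hA₁.2.trans hσ.2⟩
    refine ⟨_, _, ?_, Exec.andThen hE₁ (Exec.andThen hE₂
      (Exec.store _ _ _ _)), ⟨fun y hy => ?_, ?_⟩, fun y hy hy' => ?_⟩
    · simp only [Exp.cost, time, Polynomial.eval_add, Polynomial.eval_ofNat]
      omega
    · simp [run, hA₂.1 y (by omega), hA₁.1 y (by omega), hσ.1 y hy]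
    · simp only [Exp.eval, run, State.setArr, hv₂, hev, hA₂.1 d (by omega), hv₁,
        BExp.eval_congr h1 hσ, hA₂.2, hA₁.2, hσ.2]
    · simp [hA₂.1 y (by omega), hA₁.1 y hy]
  | seq c₁ c₂ ih₁ ih₂ =>
    obtain ⟨t₁, σ₁, ht₁, hE₁, hA₁, hv₁⟩ := ih₁ hc.1 hd hσ hB
    obtain ⟨t₂, σ₂, ht₂, hE₂, hA₂, hv₂⟩ := ih₂ hc.2 hd hA₁
      (fun r hr => by rw [run_reg_lt hc.1 _ hr]; exact hB r hr)
    refine ⟨_, _, ?_, Exec.andThen hE₁ hE₂, hA₂, fun y hy hy' => ?_⟩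
    · simp only [time, Polynomial.eval_add]
      omega
    · rw [hv₂ y hy hy', hv₁ y hy hy']
  | branch e c₁ c₂ ih₁ ih₂ =>
    obtain ⟨h1, h2, h3⟩ := hc
    obtain ⟨t, σ', ht, hE, hA, hv⟩ := BExp.exec_compile hK h1 hd (s := σ) (B := B)
      (fun r hr => by rw [hσ.1 r (by omega)]; exact hB r hr)
    have hA' : AgreeBelow D σ' s :=
      ⟨fun y hy => (hA.1 y (by omega)).trans (hσ.1 y hy), hA.2.trans hσ.2⟩
    rw [BExp.eval_congr h1 hσ] at hv
    by_cases he : e.eval s = 0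
    · obtain ⟨t₂, σ₂, ht₂, hE₂, hA₂, hv₂⟩ := ih₂ h3 hd hA' hB
      refine ⟨_, _, ?_, Exec.andThen hE
        (Exec.branch_false _ _ _ _ _ _ (by simpa [Exp.eval, hv] using he) hE₂), ?_,
        fun y hy hy' => ?_⟩
      · simp only [Exp.cost, time, Polynomial.eval_add, Polynomial.eval_ofNat]
        omega
      · simpa [run, he] using hA₂
      · rw [hv₂ y hy hy', hA.1 y hy]
    · obtain ⟨t₂, σ₂, ht₂, hE₂, hA₂, hv₂⟩ := ih₁ h2 hd hA' hB
      refine ⟨_, _, ?_, Exec.andThen hE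
        (Exec.branch_true _ _ _ _ _ _ (by simpa [Exp.eval, hv] using he) hE₂), ?_,
        fun y hy hy' => ?_⟩
      · simp only [Exp.cost, time, Polynomial.eval_add, Polynomial.eval_ofNat]
        omega
      · simpa [run, he] using hA₂
      · rw [hv₂ y hy hy', hA.1 y hy]
  | loop x r c ih =>
    obtain ⟨h1, h2, h3, h4⟩ := hc
    let S : ℕ → State := fun k => Nat.rec s (fun j s' => c.run (s'.setReg x j)) k
    have hS : ∀ k, ∀ y < K, (S k).reg y = s.reg y := by
      intro k y hy
      induction k with
      | zero => rfl
      | succ k ihk =>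
        change (c.run ((S k).setReg x k)).reg y = _
        rw [run_reg_lt h4 _ hy, State.setReg_reg, if_neg (by omega), ihk]
    obtain ⟨t, σ', ht, hE, hI⟩ := Exec.loop_of_invariant (x := d) (r := r) (R := s.reg r)
      (T := c.time.eval B + 6) (s := σ.setReg d 0)
      (c := .seq (.assign x (.reg d)) <| .seq (c.compile (d + 1)) <|
        .assign d (.add (.reg d) (.lit 1)))
      (fun j τ => AgreeBelow D τ (S j) ∧ τ.reg d = j ∧ ∀ y < d, D ≤ y → τ.reg y = σ.reg y)
      (fun j τ h => ⟨h.2.1, by rw [h.1.1 r (by omega), hS j r h3]⟩) (fun j τ _ h => by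
        obtain ⟨g1, g2, g3⟩ := h
        obtain ⟨t, τ', ht, hE, hA, hv⟩ := ih h4 (d := d + 1) (by omega) (g1.setReg x j)
          (fun r' hr' => by
            rw [State.setReg_reg, if_neg (by omega), hS j r' hr']; exact hB r' hr')
        have hE' : Exec (c.compile (d + 1)) (τ.setReg x ((Exp.reg d).eval τ)) t τ' := by
          simpa [Exp.eval, g2] using hE
        refine ⟨_, _, ?_, Exec.andThen (Exec.assign' _ _ _)
          (Exec.andThen hE' (Exec.assign' _ _ _)), ⟨fun y hy => ?_, ?_⟩, ?_, fun y hy hy' => ?_⟩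
        · simp only [Exp.cost]
          omega
        · rw [State.setReg_reg, if_neg (by omega)]
          exact hA.1 y hy
        · exact hA.2
        · have hxd : d ≠ x := by omega
          simp [Exp.eval, hv d (by omega) hd, hxd, g2]
        · rw [State.setReg_reg, if_neg (by omega), hv y (by omega) hy', State.setReg_reg,
            if_neg (by omega), g3 y hy hy'])
      ⟨⟨fun y hy => by rw [State.setReg_reg, if_neg (by omega)]; exact hσ.1 y hy, hσ.2⟩, by simp,
        fun y hy _ => by rw [State.setReg_reg, if_neg (by omega)]⟩
    refine ⟨_, _, ?_, Exec.andThen (Exec.assign' _ _ _) hE, hI.1, hI.2.2⟩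
    have hRB : s.reg r * (c.time.eval B + 6 + 4) ≤ B * (c.time.eval B + 10) :=
      Nat.mul_le_mul_right _ (hB r h3)
    simp only [Exp.cost, time, Polynomial.eval_add, Polynomial.eval_ofNat, Polynomial.eval_mul,
      Polynomial.eval_X]
    omega

end BProg

end RAM

/-! ### Demands on groups of objects, and the auction -/

namespace Auction

/-- The number of objects with key `κ` for agent `i`. -/
def groupCard (m : ℕ) (key : ℕ → ℕ → ℕ) (i κ : ℕ) : ℕ :=
  ((Finset.range m).filter fun o => key i o = κ).card

/-- The number of objects with key `κ` for agent `i` that `own` gives to agent `i`. -/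
def heldCard (m : ℕ) (key : ℕ → ℕ → ℕ) (own : ℕ → ℕ) (i κ : ℕ) : ℕ :=
  ((Finset.range m).filter fun o => own o = i ∧ key i o = κ).card

/-- Every agent `i < n` gets enough of every nonempty group with a key other than `0`: at least
the fraction `1 / n` of it, and more than that if `st i = 1`. A value `own o ≥ n` means that
nobody gets the object `o`. -/
def Satisfies (n m : ℕ) (key : ℕ → ℕ → ℕ) (st : ℕ → ℕ) (own : ℕ → ℕ) : Prop :=
  ∀ i < n, ∀ e < m, key i e ≠ 0 →
    groupCard m key i (key i e) + st i ≤ n * heldCard m key own i (key i e)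

/-- Agent `i` bids for the object `o`: the agent's demand on the group of `o` is not yet met, and
`o` is a cheapest object of the group, with a price of at most `m`. -/
def Bids (n m : ℕ) (key : ℕ → ℕ → ℕ) (st : ℕ → ℕ) (own pr : ℕ → ℕ) (i o : ℕ) : Prop :=
  key i o ≠ 0 ∧ pr o < m + 1 ∧
    n * heldCard m key own i (key i o) < groupCard m key i (key i o) + st i ∧
    ∀ o' < m, key i o' = key i o → pr o ≤ pr o'

/-- The invariant of the auction: owned objects lie in a demanded group; unowned objects are free;
the price of an owned object exceeds that of no other object of its group by more than `1`; no
agent has an object too many in a group; prices are at most `m + 1`. -/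
structure Invariant (n m : ℕ) (key : ℕ → ℕ → ℕ) (st : ℕ → ℕ) (own pr : ℕ → ℕ) : Prop where
  key_ne : ∀ o < m, own o < n → key (own o) o ≠ 0
  free : ∀ o < m, n ≤ own o → pr o = 0
  cheap : ∀ o < m, own o < n → ∀ o' < m, key (own o) o' = key (own o) o → pr o ≤ pr o' + 1
  tight : ∀ i < n, ∀ κ, heldCard m key own i κ ≠ 0 →
    n * heldCard m key own i κ < groupCard m key i κ + st i + n
  price_le : ∀ o < m, pr o ≤ m + 1

variable {n m : ℕ} {key : ℕ → ℕ → ℕ} {st own pr : ℕ → ℕ}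

/-- At the start, every object has the owner `n`, that is, none. -/
lemma invariant_init : Invariant n m key st (fun _ => n) (fun _ => 0) where
  key_ne _ _ h := absurd h (lt_irrefl _)
  free _ _ _ := rfl
  cheap _ _ h := absurd h (lt_irrefl _)
  tight i hi κ h := absurd (by simp [heldCard, hi.ne']) h
  price_le _ _ := Nat.zero_le _

lemma heldCard_congr {own' : ℕ → ℕ} (h : ∀ o < m, own o = own' o) (i κ : ℕ) :
    heldCard m key own i κ = heldCard m key own' i κ := by
  unfold heldCard
  congr 1
  exact Finset.filter_congr fun o ho => by rw [h o (Finset.mem_range.1 ho)]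

lemma Invariant.congr {own' pr' : ℕ → ℕ} (h : Invariant n m key st own pr)
    (ho : ∀ o < m, own o = own' o) (hp : ∀ o < m, pr o = pr' o) :
    Invariant n m key st own' pr' where
  key_ne o h1 h2 := by rw [← ho o h1] at h2 ⊢; exact h.key_ne o h1 h2
  free o h1 h2 := by rw [← ho o h1] at h2; rw [← hp o h1]; exact h.free o h1 h2
  cheap o h1 h2 o' h3 h4 := by
    rw [← ho o h1] at h2 h4
    rw [← hp o h1, ← hp o' h3]
    exact h.cheap o h1 h2 o' h3 h4
  tight i hi κ hκ := by
    rw [← heldCard_congr ho] at hκ ⊢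
    exact h.tight i hi κ hκ
  price_le o h1 := by rw [← hp o h1]; exact h.price_le o h1

lemma Invariant.bid (h : Invariant n m key st own pr) {i o : ℕ} (hi : i < n) (ho : o < m)
    (hb : Bids n m key st own pr i o) :
    Invariant n m key st (Function.update own o i) (Function.update pr o (pr o + 1)) := by
  obtain ⟨b1, b2, b3, b4⟩ := hb
  refine ⟨fun a ha hn => ?_, fun a ha hn => ?_, fun a ha hn a' ha' hk => ?_,
    fun j hj κ hκ => ?_, fun a ha => ?_⟩
  · by_cases hao : a = o
    · simpa [hao] using b1
    · simp only [Function.update_of_ne hao] at hn ⊢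
      exact h.key_ne a ha hn
  · by_cases hao : a = o
    · subst hao
      simp at hn
      omega
    · simp only [Function.update_of_ne hao] at hn ⊢
      exact h.free a ha hn
  · have hmono : pr a' ≤ Function.update pr o (pr o + 1) a' := by
      by_cases h' : a' = o
      · simp [h']
      · simp [h']
    by_cases hao : a = o
    · subst hao
      simp only [Function.update_self] at hk ⊢
      have := b4 a' ha' hk
      omega
    · simp only [Function.update_of_ne hao] at hn hk ⊢
      have := h.cheap a ha hn a' ha' hk
      omega
  · by_cases hji : j = i ∧ κ = key i o
    · obtain ⟨rfl, rfl⟩ := hji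
      have : heldCard m key (Function.update own o j) j (key j o) ≤
          heldCard m key own j (key j o) + 1 := by
        refine (Finset.card_le_card ?_).trans (Finset.card_insert_le o _)
        intro a ha
        simp only [Finset.mem_filter, Finset.mem_insert] at ha ⊢
        by_cases hao : a = o
        · exact Or.inl hao
        · simpa [hao] using ha
      have := Nat.mul_le_mul_left n this
      rw [Nat.mul_add] at this
      omega
    · have : heldCard m key (Function.update own o i) j κ ≤ heldCard m key own j κ := by
        refine Finset.card_le_card fun a ha => ?_
        simp only [Finset.mem_filter] at ha ⊢
        by_cases hao : a = o
        · subst hao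
          simp only [Function.update_self] at ha
          obtain ⟨_, rfl, rfl⟩ := ha
          exact absurd ⟨rfl, rfl⟩ hji
        · simpa [hao] using ha
      have h2 := h.tight j hj κ (by omega)
      have := Nat.mul_le_mul_left n this
      omega
  · by_cases hao : a = o
    · subst hao
      simpa using b2
    · simpa [hao] using h.price_le a ha

/-- If nobody bids any more although some demand is not met, then no ownership meets all demands.
As there are more prices than objects, some price `l ≤ m` does not occur. A group of which an
object dearer than `l` is owned consists of such objects, and so does the group whose demand is
not met. Hence the owners of the objects dearer than `l` need more of these objects than there
are. -/
lemma Invariant.not_satisfies (h : Invariant n m key st own pr)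
    (hb : ∀ i < n, ∀ o < m, ¬ Bids n m key st own pr i o)
    (hs : ¬ Satisfies n m key st own) (f : ℕ → ℕ) : ¬ Satisfies n m key st f := by
  intro hf
  simp only [Satisfies, not_forall, not_le] at hs
  obtain ⟨i₀, hi₀, e₀, he₀, hk₀, hu⟩ := hs
  have hdear : ∀ o < m, key i₀ o = key i₀ e₀ → m + 1 ≤ pr o := by
    obtain ⟨a, ha, hmin⟩ := Finset.exists_min_image
      ((Finset.range m).filter fun o => key i₀ o = key i₀ e₀) pr
      ⟨e₀, by simpa using he₀⟩
    simp only [Finset.mem_filter, Finset.mem_range, and_imp] at ha hmin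
    have hnb := hb i₀ hi₀ a ha.1
    have : m + 1 ≤ pr a := by
      by_contra hlt
      exact hnb ⟨by rwa [ha.2], by omega, by rwa [ha.2],
        fun o' ho' hk => hmin o' ho' (hk.trans ha.2)⟩
    exact fun o ho hk => this.trans (hmin o ho hk)
  -- there are more prices up to `m` than objects
  obtain ⟨l, hl, hlu⟩ : ∃ l < m + 1, ∀ o < m, pr o ≠ l := by
    by_contra! hall
    have : Finset.range (m + 1) ⊆ (Finset.range m).image pr := by
      intro l hl
      obtain ⟨o, ho, rfl⟩ := hall l (Finset.mem_range.1 hl)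
      exact Finset.mem_image_of_mem _ (Finset.mem_range.2 ho)
    have := (Finset.card_le_card this).trans Finset.card_image_le
    simp at this
  let H := (Finset.range m).filter fun o => l < pr o
  have hH : ∀ o, o ∈ H ↔ o < m ∧ l < pr o := fun o => by simp [H]
  have hown : ∀ o ∈ H, own o < n := by
    intro o ho
    obtain ⟨h1, h2⟩ := (hH o).1 ho
    by_contra hn
    have := h.free o h1 (not_lt.1 hn)
    omega
  -- the dear objects are counted by agent and group, for the ownerships `own` and `f`
  let φ : ℕ → ℕ × ℕ := fun o => (own o, key (own o) o)
  let ψ : ℕ → ℕ × ℕ := fun o => (f o, key (f o) o)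
  let P := insert (i₀, key i₀ e₀) (H.image φ)
  have hφ : H.card = ∑ p ∈ P, (H.filter fun o => φ o = p).card :=
    Finset.card_eq_sum_card_fiberwise fun o ho =>
      Finset.mem_insert_of_mem (Finset.mem_image_of_mem φ ho)
  have hψ : ∑ p ∈ P, (H.filter fun o => ψ o = p).card ≤ H.card := by
    rw [← Finset.card_biUnion]
    · exact Finset.card_le_card (Finset.biUnion_subset.2 fun p _ => Finset.filter_subset _ _)
    · intro p _ q _ hpq
      refine Finset.disjoint_left.2 fun o ho ho' => hpq ?_
      rw [← (Finset.mem_filter.1 ho).2, ← (Finset.mem_filter.1 ho').2]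
  -- a group that consists of dear objects contributes all objects that its agent gets of it
  have hfib : ∀ (g : ℕ → ℕ) (i κ : ℕ), (∀ o < m, key i o = κ → o ∈ H) →
      (H.filter fun o => (g o, key (g o) o) = (i, κ)).card = heldCard m key g i κ := by
    intro g i κ hsub
    unfold heldCard
    congr 1
    ext o
    simp only [Finset.mem_filter, Finset.mem_range, Prod.mk.injEq]
    constructor
    · rintro ⟨h1, rfl, h2⟩
      exact ⟨((hH o).1 h1).1, rfl, h2⟩
    · rintro ⟨h1, rfl, h2⟩
      exact ⟨hsub o h1 h2, rfl, h2⟩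
  have hsub₀ : ∀ o < m, key i₀ o = key i₀ e₀ → o ∈ H := fun o ho hk =>
    (hH o).2 ⟨ho, by have := hdear o ho hk; omega⟩
  have hlt₀ : (H.filter fun o => φ o = (i₀, key i₀ e₀)).card <
      (H.filter fun o => ψ o = (i₀, key i₀ e₀)).card := by
    rw [hfib own _ _ hsub₀, hfib f _ _ hsub₀]
    exact Nat.lt_of_mul_lt_mul_left (hu.trans_le (hf i₀ hi₀ e₀ he₀ hk₀))
  have hlt : ∑ p ∈ P, (H.filter fun o => φ o = p).card <
      ∑ p ∈ P, (H.filter fun o => ψ o = p).card := by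
    refine Finset.sum_lt_sum (fun p hp => ?_) ⟨_, Finset.mem_insert_self _ _, hlt₀⟩
    rcases Finset.mem_insert.1 hp with rfl | hp
    · exact hlt₀.le
    obtain ⟨o, ho, rfl⟩ := Finset.mem_image.1 hp
    obtain ⟨hom, hol⟩ := (hH o).1 ho
    have hsub : ∀ o' < m, key (own o) o' = key (own o) o → o' ∈ H := by
      intro o' ho' hk
      have h1 := h.cheap o hom (hown o ho) o' ho' hk
      have h2 := hlu o' ho'
      exact (hH o').2 ⟨ho', by omega⟩
    rw [show φ o = (own o, key (own o) o) from rfl, hfib own _ _ hsub, hfib f _ _ hsub]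
    have h1 := hf (own o) (hown o ho) o hom (h.key_ne o hom (hown o ho))
    by_cases hz : heldCard m key own (own o) (key (own o) o) = 0
    · omega
    have h2 := h.tight (own o) (hown o ho) _ hz
    refine Nat.lt_succ_iff.1 (Nat.lt_of_mul_lt_mul_left (a := n) ?_)
    rw [Nat.mul_succ]
    omega
  omega

end Auction

/-! ### Weak SD proportionality as a system of demands -/

section TotalPreorder

variable {O : Type*} [Fintype O] (R : O → O → Prop)

open Classical in
/-- The objects that are at least as good as `o`. -/
noncomputable def upperContour (o : O) : Finset O := Finset.univ.filter fun x => R x o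

variable {R}

@[simp] lemma mem_upperContour {o x : O} : x ∈ upperContour R o ↔ R x o := by
  simp [upperContour]

lemma upperContour_subset (ht : ∀ a b c, R a b → R b c → R a c) {x y : O} (h : R x y) :
    upperContour R x ⊆ upperContour R y := fun z hz => by
  rw [mem_upperContour] at hz ⊢
  exact ht _ _ _ hz h

/-- The size of the upper contour set identifies the indifference class. -/
lemma card_upperContour_eq_iff (hc : ∀ a b, R a b ∨ R b a)
    (ht : ∀ a b c, R a b → R b c → R a c) {x y : O} :
    (upperContour R x).card = (upperContour R y).card ↔ R x y ∧ R y x := by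
  refine ⟨fun h => ?_, fun h => le_antisymm
    (Finset.card_le_card (upperContour_subset ht h.1))
    (Finset.card_le_card (upperContour_subset ht h.2))⟩
  have hr : ∀ a, R a a := fun a => (hc a a).elim id id
  rcases hc x y with hxy | hxy
  · have := Finset.eq_of_subset_of_card_le (upperContour_subset ht hxy) h.ge
    exact ⟨hxy, mem_upperContour.1 (this ▸ mem_upperContour.2 (hr y))⟩
  · have := Finset.eq_of_subset_of_card_le (upperContour_subset ht hxy) h.le
    exact ⟨mem_upperContour.1 (this ▸ mem_upperContour.2 (hr x)), hxy⟩

/-- If a set `S` contains exactly the fraction `1 / n` of every upper contour set, then it contains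
at least that fraction of every indifference class, because such a class is the difference of two
upper contour sets (or is one itself). -/
lemma card_class_le (hc : ∀ a b, R a b ∨ R b a) (ht : ∀ a b c, R a b → R b c → R a c)
    {n : ℕ} {S : O → Prop} [DecidablePred S]
    (h₁ : ∀ o, n * ((upperContour R o).filter S).card ≤ (upperContour R o).card)
    (h₂ : ∀ o, (upperContour R o).card ≤ n * ((upperContour R o).filter S).card) (e : O) :
    (Finset.univ.filter fun x => (upperContour R x).card = (upperContour R e).card).card ≤
      n * (Finset.univ.filter fun x =>
        S x ∧ (upperContour R x).card = (upperContour R e).card).card := by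
  classical
  -- `V` is empty or the upper contour set of its worst elements
  let V := (upperContour R e).filter fun x => ¬ R e x
  have hV : n * (V.filter S).card ≤ V.card := by
    rcases V.eq_empty_or_nonempty with h0 | h0
    · simp [h0]
    · obtain ⟨v, hv, hmax⟩ := V.exists_max_image (fun x => (upperContour R x).card) h0
      have hv' : R v e ∧ ¬ R e v := by simpa [V] using hv
      have : V = upperContour R v := by
        ext x
        constructor
        · intro hx
          have hcard := hmax x hx
          rw [mem_upperContour]
          rcases hc x v with hxv | hxv
          · exact hxv
          · exact ((card_upperContour_eq_iff hc ht).1 (le_antisymm hcard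
              (Finset.card_le_card (upperContour_subset ht hxv)))).1
        · intro hx
          rw [mem_upperContour] at hx
          simp only [V, Finset.mem_filter, mem_upperContour]
          exact ⟨ht _ _ _ hx hv'.1, fun hex => hv'.2 (ht _ _ _ hex hx)⟩
      rw [this]
      exact h₁ v
  have hE : (Finset.univ.filter fun x => (upperContour R x).card = (upperContour R e).card) =
      (upperContour R e).filter fun x => R e x := by
    ext x
    simp [card_upperContour_eq_iff hc ht]
  have hES : (Finset.univ.filter fun x =>
      S x ∧ (upperContour R x).card = (upperContour R e).card) =
      ((upperContour R e).filter S).filter fun x => R e x := by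
    ext x
    simp [card_upperContour_eq_iff hc ht]
    tauto
  have hVS : V.filter S = ((upperContour R e).filter S).filter fun x => ¬ R e x := by
    ext x
    simp [V]
    tauto
  rw [hE, hES]
  have c₁ := Finset.card_filter_add_card_filter_not (s := upperContour R e) fun x => R e x
  have c₂ := Finset.card_filter_add_card_filter_not
    (s := (upperContour R e).filter S) fun x => R e x
  rw [← hVS] at c₂
  have h := h₂ e
  rw [← c₁, ← c₂, Nat.mul_add] at h
  have : ((upperContour R e).filter fun x => ¬ R e x).card = V.card := rfl
  omega

/-- A set that contains at least the fraction `1 / n` of every indifference class contains at least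
that fraction of every upper contour set, which is a disjoint union of classes. -/
lemma card_upperContour_le (hc : ∀ a b, R a b ∨ R b a) (ht : ∀ a b c, R a b → R b c → R a c)
    {n : ℕ} {S : O → Prop} [DecidablePred S]
    (h : ∀ e, (Finset.univ.filter fun x =>
        (upperContour R x).card = (upperContour R e).card).card ≤
      n * (Finset.univ.filter fun x =>
        S x ∧ (upperContour R x).card = (upperContour R e).card).card) (o : O) :
    (upperContour R o).card ≤ n * ((upperContour R o).filter S).card := by
  let c : O → ℕ := fun x => (upperContour R x).card
  have hm : ∀ x ∈ upperContour R o, c x ∈ (upperContour R o).image c :=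
    fun x hx => Finset.mem_image_of_mem c hx
  rw [Finset.card_eq_sum_card_fiberwise hm, Finset.card_eq_sum_card_fiberwise
    (s := (upperContour R o).filter S) fun x hx => hm x (Finset.mem_filter.1 hx).1,
    Finset.mul_sum]
  refine Finset.sum_le_sum fun k hk => ?_
  obtain ⟨e, he, rfl⟩ := Finset.mem_image.1 hk
  rw [mem_upperContour] at he
  have h₁ : ((upperContour R o).filter fun x => c x = c e) =
      Finset.univ.filter fun x => (upperContour R x).card = (upperContour R e).card := by
    ext x
    simp only [Finset.mem_filter, mem_upperContour, Finset.mem_univ, true_and, c,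
      and_iff_right_iff_imp, card_upperContour_eq_iff hc ht]
    exact fun hx => ht _ _ _ hx.1 he
  have h₂ : (((upperContour R o).filter S).filter fun x => c x = c e) = Finset.univ.filter
      fun x => S x ∧ (upperContour R x).card = (upperContour R e).card := by
    ext x
    simp only [Finset.mem_filter, mem_upperContour, Finset.mem_univ, true_and, c,
      card_upperContour_eq_iff hc ht]
    exact ⟨fun hx => ⟨hx.1.2, hx.2⟩, fun hx => ⟨⟨ht _ _ _ hx.2.1 he, hx.1⟩, hx.2⟩⟩
  rw [h₁, h₂]
  exact h e

end TotalPreorder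

namespace AssignmentProblem

variable {n m : ℕ} (A : AssignmentProblem n m)

/-- The two ways to be content with the set `S` of objects. -/
lemma not_strictlySDPrefers_iff (hn : n ≠ 0) {x : Fin m → ℝ} {S : Fin m → Prop} [DecidablePred S]
    (hx : ∀ o, x o = if S o then 1 else 0) (i : Fin n) :
    ¬ A.StrictlySDPrefers i (fun _ => 1 / (n : ℝ)) x ↔
      (∃ o, (upperContour (A.pref i) o).card <
        n * ((upperContour (A.pref i) o).filter S).card) ∨
      ∀ o, (upperContour (A.pref i) o).card ≤
        n * ((upperContour (A.pref i) o).filter S).card := by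
  classical
  have hn' : (0 : ℝ) < n := by positivity
  have e₁ : ∀ o, ∑ o' with A.pref i o' o, x o' =
      (((upperContour (A.pref i) o).filter S).card : ℝ) := fun o => by
    simp only [hx, Finset.sum_boole]
    rfl
  have e₂ : ∀ o, ∑ o' with A.pref i o' o, 1 / (n : ℝ) =
      ((upperContour (A.pref i) o).card : ℝ) / n := fun o => by
    rw [Finset.sum_const, nsmul_eq_mul, mul_one_div]
    rfl
  have l₁ : A.SDPrefers i (fun _ => 1 / (n : ℝ)) x ↔
      ∀ o, n * ((upperContour (A.pref i) o).filter S).card ≤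
        (upperContour (A.pref i) o).card := by
    refine forall_congr' fun o => ?_
    rw [e₁, e₂, le_div_iff₀' hn']
    exact_mod_cast Iff.rfl
  have l₂ : A.SDPrefers i x (fun _ => 1 / (n : ℝ)) ↔
      ∀ o, (upperContour (A.pref i) o).card ≤
        n * ((upperContour (A.pref i) o).filter S).card := by
    refine forall_congr' fun o => ?_
    rw [e₁, e₂, div_le_iff₀' hn']
    exact_mod_cast Iff.rfl
  rw [StrictlySDPrefers, l₁, l₂, not_and_or, not_not]
  simp only [not_forall, not_le]

/-- Discrete assignments amount to functions from the objects to the agents. -/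
lemma hasWeakSDProportionalDiscreteAssignment_iff_exists_fun (hn : n ≠ 0) :
    A.HasWeakSDProportionalDiscreteAssignment ↔ ∃ f : Fin m → Fin n, ∀ i,
      (∃ o, (upperContour (A.pref i) o).card <
        n * ((upperContour (A.pref i) o).filter fun x => f x = i).card) ∨
      ∀ o, (upperContour (A.pref i) o).card ≤
        n * ((upperContour (A.pref i) o).filter fun x => f x = i).card := by
  constructor
  · rintro ⟨p, ⟨⟨hp, hsum⟩, h01⟩, hw⟩
    have hex : ∀ o, ∃ i, p i o = 1 := by
      intro o
      by_contra! h
      have := hsum o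
      rw [Finset.sum_eq_zero fun i _ => (h01 i o).resolve_right (h i)] at this
      exact zero_ne_one this
    choose f hf using hex
    refine ⟨f, fun i => (A.not_strictlySDPrefers_iff hn (fun o => ?_) i).1 (hw i)⟩
    split_ifs with h
    · exact h ▸ hf o
    · refine (h01 i o).resolve_right fun h1 => ?_
      have hle : ∑ j ∈ ({f o, i} : Finset (Fin n)), p j o ≤ ∑ j, p j o :=
        Finset.sum_le_sum_of_subset_of_nonneg (Finset.subset_univ _) fun j _ _ => (hp j o).1
      rw [hsum, Finset.sum_pair h, hf, h1] at hle
      norm_num at hle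
  · rintro ⟨f, hf⟩
    refine ⟨fun i o => if f o = i then 1 else 0, ⟨⟨fun i o => ?_, fun o => ?_⟩, fun i o => ?_⟩,
      fun i => (A.not_strictlySDPrefers_iff hn (fun o => rfl) i).2 (hf i)⟩
    · dsimp only
      split_ifs <;> norm_num
    · simp
    · dsimp only
      split_ifs <;> simp

open Classical in
/-- The bit of the input that tells whether agent `i` finds `a` at least as good as `b`. -/
noncomputable def prefBit (i a b : ℕ) : ℕ :=
  if ∃ (hi : i < n) (ha : a < m) (hb : b < m), A.pref ⟨i, hi⟩ ⟨a, ha⟩ ⟨b, hb⟩ then 1 else 0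

open Classical in
lemma prefBit_coe (i : Fin n) (a b : Fin m) :
    A.prefBit i a b = if A.pref i a b then 1 else 0 := by
  simp [prefBit]

/-- The key that agent `i` gives to object `o` under the guess `g`. If `g i = m`, the key
identifies the indifference class of `o`. Otherwise it is `1` for the objects at least as good as
the object `g i` and `0` for the others. -/
noncomputable def key (g : ℕ → ℕ) (i o : ℕ) : ℕ :=
  if g i = m then ∑ a ∈ Finset.range m, A.prefBit i a o else A.prefBit i o (g i)

/-- Whether agent `i` demands more than the fraction `1 / n` under the guess `g`. -/
def strictness (m : ℕ) (g : ℕ → ℕ) (i : ℕ) : ℕ := if g i < m then 1 else 0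

lemma key_eq_card {g : ℕ → ℕ} {i : Fin n} (hg : g i = m) (o : Fin m) :
    A.key g i o = (upperContour (A.pref i) o).card := by
  classical
  rw [key, if_pos hg, Finset.sum_range]
  simp only [prefBit_coe, Finset.sum_boole, Nat.cast_id]
  rfl

lemma key_eq_one_iff {g : ℕ → ℕ} {i : Fin n} {a : Fin m} (hg : g i = a) (o : Fin m) :
    A.key g i o = 1 ↔ A.pref i o a := by
  rw [key, if_neg (by omega), hg, prefBit_coe]
  simp

lemma key_eq_one_of_ne_zero {g : ℕ → ℕ} {i o : ℕ} (hg : g i ≠ m) (h : A.key g i o ≠ 0) :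
    A.key g i o = 1 := by
  rw [key, if_neg hg, prefBit] at h ⊢
  split_ifs at h ⊢
  · rfl
  · exact absurd rfl h

lemma card_range_filter (m : ℕ) (P : ℕ → Prop) [DecidablePred P] :
    ((Finset.range m).filter P).card = (Finset.univ.filter fun o : Fin m => P o).card := by
  simp only [Finset.card_filter, Finset.sum_range]

open Auction in
/-- Every agent `i` either names an object `g i` such that the agent gets more than the fraction
`1 / n` of the objects at least as good as `g i`, or gets at least that fraction of every
indifference class. -/
theorem hasWeakSDProportionalDiscreteAssignment_iff (hn : n ≠ 0) :
    A.HasWeakSDProportionalDiscreteAssignment ↔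
      ∃ g : ℕ → ℕ, (∀ i < n, g i ≤ m) ∧
        ∃ f, Satisfies n m (A.key g) (strictness m g) f := by
  classical
  rw [hasWeakSDProportionalDiscreteAssignment_iff_exists_fun A hn]
  have hc := A.complete
  have ht := A.trans
  constructor
  · rintro ⟨f, hf⟩
    have hg : ∀ i : Fin n, ∃ k ≤ m, (∃ a : Fin m, k = a ∧ (upperContour (A.pref i) a).card <
        n * ((upperContour (A.pref i) a).filter fun x => f x = i).card) ∨
        (k = m ∧ ∀ e, (Finset.univ.filter fun x =>
          (upperContour (A.pref i) x).card = (upperContour (A.pref i) e).card).card ≤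
          n * (Finset.univ.filter fun x => f x = i ∧
            (upperContour (A.pref i) x).card = (upperContour (A.pref i) e).card).card) := by
      intro i
      by_cases h : ∃ o, (upperContour (A.pref i) o).card <
        n * ((upperContour (A.pref i) o).filter fun x => f x = i).card
      · obtain ⟨o, ho⟩ := h
        exact ⟨o, o.2.le, Or.inl ⟨o, rfl, ho⟩⟩
      · have h₂ := (hf i).resolve_left h
        simp only [not_exists, not_lt] at h
        exact ⟨m, le_rfl, Or.inr ⟨rfl, card_class_le (hc i) (ht i) h h₂⟩⟩
    choose g hgm hg using hg
    refine ⟨fun i => if h : i < n then g ⟨i, h⟩ else 0, fun i hi => ?_,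
      fun o => if h : o < m then f ⟨o, h⟩ else n, fun i hi e he hk => ?_⟩
    · simpa [hi] using hgm ⟨i, hi⟩
    · obtain ⟨i, rfl⟩ : ∃ j : Fin n, i = j := ⟨⟨i, hi⟩, rfl⟩
      obtain ⟨e, rfl⟩ : ∃ j : Fin m, e = j := ⟨⟨e, he⟩, rfl⟩
      set g' : ℕ → ℕ := fun i => if h : i < n then g ⟨i, h⟩ else 0 with hg'
      have hgi : g' i = g i := by simp [hg']
      simp only [groupCard, heldCard, card_range_filter, Fin.is_lt, dite_true, Fin.eta,
        Fin.val_inj]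
      rcases hg i with ⟨a, ha, hlt⟩ | ⟨hm, hle⟩
      · have hga : g' i = a := hgi.trans ha
        rw [A.key_eq_one_of_ne_zero (by omega) hk, strictness, if_pos (by omega)]
        simp only [A.key_eq_one_iff hga]
        rw [Nat.succ_le_iff]
        have hS : (Finset.univ.filter fun x => f x = i ∧ A.pref i x a) =
            (upperContour (A.pref i) a).filter fun x => f x = i := by
          ext x
          simp [and_comm]
        rw [hS]
        exact hlt
      · have hga : g' i = m := hgi.trans hm
        rw [strictness, if_neg (by omega)]
        simpa only [A.key_eq_card hga, Nat.add_zero] using hle e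
  · rintro ⟨g, hg, f, hf⟩
    have hn' : 0 < n := Nat.pos_of_ne_zero hn
    -- objects that `f` gives to nobody go to an arbitrary agent
    let f' : Fin m → Fin n := fun o => if h : f o < n then ⟨f o, h⟩ else ⟨0, hn'⟩
    have hff : ∀ (o : Fin m) (i : Fin n), f o = i → f' o = i := by
      intro o i h
      simp [f', h]
    refine ⟨f', fun i => ?_⟩
    rcases (hg i i.2).lt_or_eq with hlt | heq
    · refine Or.inl ⟨⟨g i, hlt⟩, ?_⟩
      have hga : g i = (⟨g i, hlt⟩ : Fin m) := rfl
      have hk : A.key g i (g i) = 1 :=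
        (A.key_eq_one_iff hga ⟨g i, hlt⟩).2 ((hc i _ _).elim id id)
      have h := hf i i.2 (g i) hlt (by omega)
      rw [hk, strictness, if_pos hlt] at h
      simp only [groupCard, heldCard, card_range_filter, A.key_eq_one_iff hga] at h
      refine lt_of_lt_of_le (Nat.lt_of_succ_le h) (Nat.mul_le_mul_left n
        (Finset.card_le_card fun x hx => ?_))
      simp only [Finset.mem_filter, Finset.mem_univ, true_and, mem_upperContour] at hx ⊢
      exact ⟨hx.2, hff x i hx.1⟩
    · refine Or.inr (card_upperContour_le (hc i) (ht i) fun e => ?_)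
      have hk : A.key g i e ≠ 0 := by
        rw [A.key_eq_card heq, Finset.card_ne_zero]
        exact ⟨e, mem_upperContour.2 ((hc i e e).elim id id)⟩
      have h := hf i i.2 e e.2 hk
      rw [strictness, if_neg (by omega)] at h
      simp only [groupCard, heldCard, card_range_filter, A.key_eq_card heq] at h
      refine h.trans (Nat.mul_le_mul_left n (Finset.card_le_card fun x hx => ?_))
      simp only [Finset.mem_filter, Finset.mem_univ, true_and] at hx ⊢
      exact ⟨hff x i hx.1, hx.2⟩

/-- Without agents, there is an assignment only if there are no objects. -/
lemma hasWeakSDProportionalDiscreteAssignment_iff_of_eq_zero (hn : n = 0) :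
    A.HasWeakSDProportionalDiscreteAssignment ↔ m = 0 := by
  subst hn
  constructor
  · rintro ⟨p, hp, -⟩
    by_contra hm
    have := hp.1.2 ⟨0, Nat.pos_of_ne_zero hm⟩
    simp at this
  · rintro rfl
    exact ⟨fun _ _ => 0, ⟨⟨fun i => i.elim0, fun o => o.elim0⟩, fun i => i.elim0⟩,
      fun i => i.elim0⟩

end AssignmentProblem

/-! ### The input word -/

section BlockList

lemma block_index_lt {a b c d : ℕ} (ha : a < c) (hb : b < d) : a * d + b < c * d := by
  have := Nat.mul_le_mul_right d (Nat.succ_le_of_lt ha)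
  rw [Nat.succ_mul] at this
  omega

/-- Access to a concatenation of blocks that all have length `l`. -/
lemma getElem?_flatMap_mul_add {α β : Type*} (f : α → List β) {l r : ℕ} (hr : r < l) (L : List α)
    (hf : ∀ a ∈ L, (f a).length = l) (i : ℕ) :
    (L.flatMap f)[i * l + r]? = L[i]?.bind fun a => (f a)[r]? := by
  induction L generalizing i with
  | nil => simp
  | cons a L ih =>
    have ha := hf a (by simp)
    rw [List.flatMap_cons]
    cases i with
    | zero => simp [List.getElem?_append_left (show r < (f a).length by omega)]
    | succ i =>
      rw [List.getElem?_append_right (by rw [ha, Nat.succ_mul]; omega), ha,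
        show (i + 1) * l + r - l = i * l + r by rw [Nat.succ_mul]; omega,
        ih fun b hb => hf b (by simp [hb])]
      simp

lemma length_flatMap_eq_mul {α β : Type*} (f : α → List β) {l : ℕ} (L : List α)
    (hf : ∀ a ∈ L, (f a).length = l) : (L.flatMap f).length = L.length * l := by
  induction L with
  | nil => simp
  | cons a L ih =>
    rw [List.flatMap_cons, List.length_append, hf a (by simp), ih fun b hb => hf b (by simp [hb]),
      List.length_cons, Nat.succ_mul, add_comm]

end BlockList

namespace AssignmentProblem

variable {n m : ℕ} (A : AssignmentProblem n m)

lemma length_encode : A.encode.length = n + m + 2 + n * m ^ 2 := by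
  simp only [encode, List.length_append, List.length_replicate, List.length_cons]
  rw [length_flatMap_eq_mul (l := m * m), List.length_finRange]
  · ring
  · intro i _
    rw [length_flatMap_eq_mul (l := m), List.length_finRange]
    simp

/-- The unary parts of the input word: `0` marks the end of each of them. -/
lemma init_encode_arr (k : ℕ) (hk : k < n + m + 2) :
    (RAM.init A.encode).arr 0 k = if k = n ∨ k = n + 1 + m then 0 else 1 := by
  simp only [RAM.init, encode, true_and]
  rcases lt_trichotomy k n with h | rfl | h
  · rw [List.getElem?_append_left (by simpa using h)]
    simp [h, show k ≠ n by omega, show k ≠ n + 1 + m by omega]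
  · rw [List.getElem?_append_right (by simp)]
    simp
  · obtain ⟨j, rfl⟩ := Nat.exists_eq_add_of_lt h
    rw [List.getElem?_append_right (by simp; omega)]
    simp only [List.length_replicate]
    rw [show n + j + 1 - n = j + 1 by omega, List.getElem?_cons_succ]
    rcases (show j ≤ m by omega).lt_or_eq with h | rfl
    · rw [List.getElem?_append_left (by simpa using h)]
      simp [h]
      omega
    · rw [List.getElem?_append_right (by simp)]
      simp
      omega

lemma init_encode_arr_bit {i a b : ℕ} (hi : i < n) (ha : a < m) (hb : b < m) :
    (RAM.init A.encode).arr 0 (n + m + 2 + ((i * m + a) * m + b)) = A.prefBit i a b := by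
  classical
  have hlt : a * m + b < m * m := block_index_lt ha hb
  have hlen : ∀ i : Fin n, ((List.finRange m).flatMap fun a => (List.finRange m).map fun b =>
      decide (A.pref i a b)).length = m * m := fun i => by
    rw [length_flatMap_eq_mul (l := m), List.length_finRange]
    simp
  have key : A.encode[n + m + 2 + ((i * m + a) * m + b)]? =
      some (decide (A.pref ⟨i, hi⟩ ⟨a, ha⟩ ⟨b, hb⟩)) := by
    rw [encode, List.getElem?_append_right (by simp; omega)]
    simp only [List.length_replicate]
    rw [show n + m + 2 + ((i * m + a) * m + b) - n = (m + 1 + ((i * m + a) * m + b)) + 1 by omega,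
      List.getElem?_cons_succ, List.getElem?_append_right (by simp; omega)]
    simp only [List.length_replicate]
    rw [show m + 1 + ((i * m + a) * m + b) - m = ((i * m + a) * m + b) + 1 by omega,
      List.getElem?_cons_succ, show (i * m + a) * m + b = i * (m * m) + (a * m + b) by ring,
      getElem?_flatMap_mul_add _ hlt _ fun i _ => by convert hlen i]
    rw [List.getElem?_eq_getElem (by simpa using hi), Option.bind_some,
      getElem?_flatMap_mul_add _ hb _ fun i _ => by simp,
      List.getElem?_eq_getElem (by simpa using ha), Option.bind_some]
    simp [hb]
  simp only [RAM.init, key, prefBit, true_and, Option.some.injEq, decide_eq_true_eq]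
  simp [hi, ha, hb]

end AssignmentProblem

/-! ### The program -/

namespace RAM

namespace BExp

/-- The truth value of `e₁ < e₂`. -/
def lt (e₁ e₂ : BExp) : BExp := sub (lit 1) (sub (lit 1) (sub e₂ e₁))

/-- The truth value of `e₁ = e₂`. -/
def eq (e₁ e₂ : BExp) : BExp := sub (lit 1) (add (sub e₁ e₂) (sub e₂ e₁))

/-- The truth value of `e₁ ≠ 0 ∧ e₂ ≠ 0`. -/
def and (e₁ e₂ : BExp) : BExp :=
  sub (lit 1) (add (sub (lit 1) e₁) (sub (lit 1) e₂))

@[simp] lemma eval_lt (s : State) (e₁ e₂ : BExp) :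
    (lt e₁ e₂).eval s = if e₁.eval s < e₂.eval s then 1 else 0 := by
  simp only [lt, eval]
  split_ifs <;> omega

@[simp] lemma eval_eq (s : State) (e₁ e₂ : BExp) :
    (eq e₁ e₂).eval s = if e₁.eval s = e₂.eval s then 1 else 0 := by
  simp only [eq, eval]
  split_ifs <;> omega

@[simp] lemma eval_and (s : State) (e₁ e₂ : BExp) :
    (and e₁ e₂).eval s = if e₁.eval s ≠ 0 ∧ e₂.eval s ≠ 0 then 1 else 0 := by
  simp only [and, eval]
  split_ifs <;> omega

@[simp] lemma scoped_lt {K D : ℕ} {e₁ e₂ : BExp} :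
    (lt e₁ e₂).Scoped K D ↔ e₁.Scoped K D ∧ e₂.Scoped K D := by
  simp only [lt, Scoped]
  tauto

@[simp] lemma scoped_eq {K D : ℕ} {e₁ e₂ : BExp} :
    (eq e₁ e₂).Scoped K D ↔ e₁.Scoped K D ∧ e₂.Scoped K D := by
  simp only [eq, Scoped]
  tauto

@[simp] lemma scoped_and {K D : ℕ} {e₁ e₂ : BExp} :
    (and e₁ e₂).Scoped K D ↔ e₁.Scoped K D ∧ e₂.Scoped K D := by
  simp only [and, Scoped]
  tauto

end BExp

end RAM

open RAM

/-! The registers of the program: `0` the length of the input, `1` the number `n` of agents, `2`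
the number `m` of objects, `3` the number `m + 1`, `4` the position of the first preference bit,
`5` the number of rounds of the auction, `6` the number of guesses, `7` the answer, `8` the guess,
`9` and `11` quotients of the guess, `10` an agent, `12` an object, `13` a round, `20` and `21`
summation variables.
The arrays: `0` the input, `1` the multiples of `m`, `2` the digits of the guess, `3` the keys,
`4` the owners, `5` the prices. -/

namespace WeakSDProgram

open BExp BProg

/-- Reads `n` and `m` off the input and tabulates the multiples of `m`. The numbers `n` and `m`
are found by counting the positions up to which a run of ones extends. -/
def parse : BProg :=
  .seq (.assign 1 (sum 20 0 (eq (sum 21 0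
    (and (lt (reg 21) (add (reg 20) (lit 1))) (eq (get 0 (reg 21)) (lit 0)))) (lit 0)))) <|
  .seq (.assign 2 (sum 20 0 (and (lt (reg 1) (reg 20)) (eq (sum 21 0
    (and (and (lt (reg 1) (reg 21)) (lt (reg 21) (add (reg 20) (lit 1))))
      (eq (get 0 (reg 21)) (lit 0)))) (lit 0))))) <|
  .seq (.assign 3 (add (reg 2) (lit 1))) <|
  .seq (.assign 4 (add (add (reg 1) (reg 2)) (lit 2))) <|
  .loop 10 0 (.store 1 (add (reg 10) (lit 1)) (add (get 1 (reg 10)) (reg 2)))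

/-- Computes the number `m * (m + 1) + 1` of rounds and the number `(m + 1) ^ n` of guesses. -/
def bounds : BProg :=
  .seq (.assign 5 (add (sum 20 2 (reg 3)) (lit 1))) <|
  .seq (.assign 6 (lit 1)) <|
  .loop 10 1 (.assign 6 (sum 20 3 (reg 6)))

/-- Puts the `n` digits of the guess to base `m + 1` into array `2`. The quotient by `m + 1` is
the number of `q` with `(q + 1) * (m + 1)` at most the dividend. -/
def decode : BProg :=
  .seq (.assign 9 (reg 8)) <|
  .loop 10 1 <|
    .seq (.assign 11 (sum 20 6 (lt (sum 21 3 (add (reg 20) (lit 1))) (add (reg 9) (lit 1))))) <|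
    .seq (.store 2 (reg 10) (sub (reg 9) (sum 21 3 (reg 11)))) <|
    .assign 9 (reg 11)

/-- The preference bit of agent `i` and objects `a` and `b`. -/
def bitExp (i a b : BExp) : BExp := get 0 (add (reg 4) (add (get 1 (add (get 1 i) a)) b))

/-- Computes the keys that belong to the guess. -/
def keys : BProg :=
  .loop 10 1 <| .loop 12 2 <| .branch (eq (get 2 (reg 10)) (reg 2))
    (.store 3 (add (get 1 (reg 10)) (reg 12)) (sum 20 2 (bitExp (reg 10) (reg 20) (reg 12))))
    (.store 3 (add (get 1 (reg 10)) (reg 12)) (bitExp (reg 10) (reg 12) (get 2 (reg 10))))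

/-- Resets the auction: nothing is owned and all prices are `0`. -/
def reset : BProg :=
  .loop 12 2 <| .seq (.store 4 (reg 12) (reg 1)) (.store 5 (reg 12) (lit 0))

/-- The key of the object in register `x` for the agent in register `10`. -/
def keyExp (x : ℕ) : BExp := get 3 (add (get 1 (reg 10)) (reg x))

/-- The truth value of: agent `10` has an unmet demand on the group of object `12`. -/
def unmetExp : BExp :=
  and (keyExp 12) (lt
    (sum 20 2 (sum 21 1 (and (eq (get 4 (reg 20)) (reg 10)) (eq (keyExp 20) (keyExp 12)))))
    (add (sum 20 2 (eq (keyExp 20) (keyExp 12))) (lt (get 2 (reg 10)) (reg 2))))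

/-- The truth value of: agent `10` bids for object `12`. -/
def bidsExp : BExp :=
  and (and unmetExp (lt (get 5 (reg 12)) (reg 3)))
    (eq (sum 20 2 (and (eq (keyExp 20) (keyExp 12)) (lt (get 5 (reg 20)) (get 5 (reg 12)))))
      (lit 0))

/-- Lets agent `10` have object `12` for a price that is higher by `1`, if the agent bids. -/
def bid : BProg :=
  .branch bidsExp
    (.seq (.store 4 (reg 12) (reg 10)) (.store 5 (reg 12) (add (get 5 (reg 12)) (lit 1)))) .nop

/-- A round of the auction. -/
def round : BProg := .loop 10 1 <| .loop 12 2 bid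

/-- Sets register `7` to `1` if no demand is unmet. -/
def test : BProg :=
  .branch (sum 10 1 (sum 12 2 unmetExp)) .nop (.assign 7 (lit 1))

/-- Decides whether the demands that belong to the guess in register `8` can be met. -/
def tryGuess : BProg :=
  .seq decode <| .seq keys <| .seq reset <| .seq (.loop 13 5 round) test

/-- Tries all guesses. -/
def search : BProg := .loop 8 6 tryGuess

/-- The whole program. Without agents all demands are met, but there is an assignment only if
there are no objects, hence the correction in the last step. -/
def program : Prog :=
  .seq (parse.compile 30) <| .seq (bounds.compile 30) <| .seq (search.compile 30) <|
  .assign 0 (.sub (.reg 7) (.sub (.sub (.lit 1) (.reg 1)) (.sub (.lit 1) (.reg 2))))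

lemma scoped_parse : parse.Scoped 1 30 := by
  simp [parse, BProg.Scoped, BExp.Scoped]

lemma scoped_bounds : bounds.Scoped 5 30 := by
  simp [bounds, BProg.Scoped, BExp.Scoped]

lemma scoped_decode : decode.Scoped 7 30 := by
  simp [decode, BProg.Scoped, BExp.Scoped]

lemma scoped_keys : keys.Scoped 7 30 := by
  simp [keys, bitExp, BProg.Scoped, BExp.Scoped]

lemma scoped_reset : reset.Scoped 7 30 := by
  simp [reset, BProg.Scoped, BExp.Scoped]

lemma scoped_round : round.Scoped 7 30 := by
  simp [round, bid, bidsExp, unmetExp, keyExp, BProg.Scoped, BExp.Scoped]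

lemma scoped_test : test.Scoped 7 30 := by
  simp [test, unmetExp, keyExp, BProg.Scoped, BExp.Scoped]

lemma scoped_tryGuess : tryGuess.Scoped 7 30 := by
  simp [tryGuess, BProg.Scoped, scoped_decode, scoped_keys, scoped_reset, scoped_round,
    scoped_test]

lemma scoped_search : search.Scoped 7 30 := by
  simp [search, BProg.Scoped, scoped_tryGuess]

/-! ### Correctness of the parts of the program -/

variable {n m : ℕ} {A : AssignmentProblem n m}

/-- The results of parsing are in place. -/
structure Parsed (A : AssignmentProblem n m) (s : State) : Prop where
  agents : s.reg 1 = n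
  objects : s.reg 2 = m
  succ_objects : s.reg 3 = m + 1
  offset : s.reg 4 = n + m + 2
  bit : ∀ i < n, ∀ a < m, ∀ b < m,
    s.arr 0 (n + m + 2 + ((i * m + a) * m + b)) = A.prefBit i a b
  multiple : ∀ k ≤ n * m, s.arr 1 k = k * m

lemma Parsed.congr {s s' : State} (h : Parsed A s) (hr : ∀ x < 5, s'.reg x = s.reg x)
    (h0 : s'.arr 0 = s.arr 0) (h1 : s'.arr 1 = s.arr 1) : Parsed A s' where
  agents := by rw [hr 1 (by omega), h.agents]
  objects := by rw [hr 2 (by omega), h.objects]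
  succ_objects := by rw [hr 3 (by omega), h.succ_objects]
  offset := by rw [hr 4 (by omega), h.offset]
  bit := by rw [h0]; exact h.bit
  multiple := by rw [h1]; exact h.multiple

lemma Parsed.setReg {s : State} (h : Parsed A s) {x : ℕ} (hx : 5 ≤ x) (v : ℕ) :
    Parsed A (s.setReg x v) :=
  h.congr (fun y hy => by rw [State.setReg_reg, if_neg (by omega)]) rfl rfl

lemma Parsed.run {s : State} (h : Parsed A s) {c : BProg} {K : ℕ} (hK : 5 ≤ K)
    (hc : c.Scoped K 30) (h0 : ¬ c.Stores 0) (h1 : ¬ c.Stores 1) : Parsed A (c.run s) :=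
  h.congr (fun _ hy => run_reg_lt hc s (by omega)) (run_arr_of_not_stores h0 s)
    (run_arr_of_not_stores h1 s)

lemma Parsed.multiple_lt {s : State} (h : Parsed A s) {i a : ℕ} (hi : i < n) (ha : a < m) :
    s.arr 1 i = i * m ∧ s.arr 1 (i * m + a) = (i * m + a) * m := by
  have hlt := block_index_lt hi ha
  have hm : i * 1 ≤ i * m := Nat.mul_le_mul_left i (by omega)
  exact ⟨h.multiple i (by omega), h.multiple _ hlt.le⟩

lemma eval_bitExp {s : State} (h : Parsed A s) {i a b : BExp} (hi : i.eval s < n)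
    (ha : a.eval s < m) (hb : b.eval s < m) :
    (bitExp i a b).eval s = A.prefBit (i.eval s) (a.eval s) (b.eval s) := by
  obtain ⟨h1, h2⟩ := h.multiple_lt hi ha
  simp only [bitExp, eval, h.offset, h1, h2]
  exact h.bit _ hi _ ha _ hb

/-- The digits of a guess to base `m + 1`. -/
def digit (m c i : ℕ) : ℕ := c / (m + 1) ^ i % (m + 1)

lemma digit_le (m c i : ℕ) : digit m c i ≤ m := Nat.lt_succ_iff.1 (Nat.mod_lt _ m.succ_pos)

/-- Every choice of digits belongs to a guess. -/
lemma exists_digit_eq (n m : ℕ) (g : ℕ → ℕ) (hg : ∀ i < n, g i ≤ m) :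
    ∃ c < (m + 1) ^ n, ∀ i < n, digit m c i = g i := by
  let g' : Fin n → Fin (m + 1) := fun i => ⟨g i, Nat.lt_succ_iff.2 (hg i i.2)⟩
  refine ⟨finFunctionFinEquiv g', (finFunctionFinEquiv g').2, fun i hi => ?_⟩
  have := congrFun (finFunctionFinEquiv.symm_apply_apply g') ⟨i, hi⟩
  exact congrArg Fin.val this

lemma run_decode {s : State} (h : Parsed A s) (hG : s.reg 8 < s.reg 6) :
    ∀ i < n, (decode.run s).arr 2 i = digit m (s.reg 8) i := by
  set c := s.reg 8 with hc
  set G := s.reg 6 with hG'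
  have key := run_loop_induction (x := 10) (r := 1) (s := s.setReg 9 c)
    (c := .seq (.assign 11 (sum 20 6 (lt (sum 21 3 (add (reg 20) (lit 1)))
      (add (reg 9) (lit 1))))) <| .seq (.store 2 (reg 10) (sub (reg 9) (sum 21 3 (reg 11)))) <|
      .assign 9 (reg 11))
    (fun j s' => s'.reg 3 = m + 1 ∧ s'.reg 6 = G ∧ s'.reg 9 = c / (m + 1) ^ j ∧
      ∀ i < j, s'.arr 2 i = digit m c i) ?_ ?_
  · simp only [State.setReg_reg] at key
    intro i hi
    rw [← h.agents] at hi
    exact key.2.2.2 i hi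
  · simp [h.succ_objects, hG']
  · rintro j s' - ⟨h3, h6, h9, hd⟩
    have hdiv : c / (m + 1) ^ j ≤ c := Nat.div_le_self _ _
    -- the quotients that are counted are those below the value of the quotient
    have hq : ((Finset.range G).filter fun q =>
        (m + 1) * (q + 1) ≤ c / (m + 1) ^ j).card = c / (m + 1) ^ (j + 1) := by
      rw [pow_succ, ← Nat.div_div_eq_div_mul]
      have hle := Nat.div_le_self (c / (m + 1) ^ j) (m + 1)
      convert Finset.card_range (c / (m + 1) ^ j / (m + 1)) using 2
      ext q
      rw [Finset.mem_filter, Finset.mem_range, Finset.mem_range, mul_comm,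
        ← Nat.le_div_iff_mul_le (show 0 < m + 1 by omega), Nat.succ_le_iff]
      omega
    simp [run, eval, h3, h6, h9, hq]
    intro i hi
    split_ifs with hij
    · rw [digit, hij, Nat.mod_def, pow_succ, Nat.div_div_eq_div_mul]
    · exact hd i (by omega)

lemma run_keys {s : State} (h : Parsed A s) (hg : ∀ i < n, s.arr 2 i ≤ m) :
    ∀ i < n, ∀ o < m, (keys.run s).arr 3 (i * m + o) = A.key (s.arr 2) i o := by
  set g := s.arr 2 with hgdef
  -- the cells of array `3` are filled in increasing order
  let I : ℕ → State → Prop := fun k s' => Parsed A s' ∧ s'.arr 2 = g ∧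
    ∀ a < k, s'.arr 3 a = A.key g (a / m) (a % m)
  have key : I (s.reg 1 * m) (keys.run s) := by
    refine run_loop_induction (fun j => I (j * m)) ⟨h, rfl, fun a ha => by simp at ha⟩ ?_
    rintro j s' hj ⟨h1, h2, h3⟩
    rw [h.agents] at hj
    have hP : Parsed A (s'.setReg 10 j) := h1.setReg (by omega) _
    have inner := run_loop_induction (x := 12) (r := 2) (s := s'.setReg 10 j)
      (c := .branch (eq (get 2 (reg 10)) (reg 2))
        (.store 3 (add (get 1 (reg 10)) (reg 12)) (sum 20 2 (bitExp (reg 10) (reg 20) (reg 12))))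
        (.store 3 (add (get 1 (reg 10)) (reg 12)) (bitExp (reg 10) (reg 12) (get 2 (reg 10)))))
      (fun k s'' => I (j * m + k) s'' ∧ s''.reg 10 = j) ⟨⟨hP, h2, h3⟩, by simp⟩ ?_
    · have hm : (s'.setReg 10 j).reg 2 = m := hP.objects
      rw [hm] at inner
      simpa only [Nat.succ_mul] using inner.1
    · rintro o s'' ho ⟨⟨g1, g2, g3⟩, g10⟩
      have hm : (s'.setReg 10 j).reg 2 = m := hP.objects
      rw [hm] at ho
      have hP' : Parsed A (s''.setReg 12 o) := g1.setReg (by omega) _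
      -- one more cell is filled, with the right value
      have fill : ∀ v, v = A.key g j o →
          I (j * m + (o + 1)) ((s''.setReg 12 o).setArr 3 (j * m + o) v) ∧
          ((s''.setReg 12 o).setArr 3 (j * m + o) v).reg 10 = j := by
        rintro v rfl
        refine ⟨⟨hP'.congr (fun _ _ => rfl) ?_ ?_, ?_, fun a ha => ?_⟩, by simp [g10]⟩
        · exact State.setArr_arr_of_ne _ _ _ _ (by omega)
        · exact State.setArr_arr_of_ne _ _ _ _ (by omega)
        · rw [State.setArr_arr_of_ne _ _ _ _ (by omega)]
          exact g2
        · rw [State.setArr_arr]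
          split_ifs with hao
          · rw [hao.2, mul_comm, Nat.mul_add_div (by omega), Nat.div_eq_of_lt ho,
              Nat.mul_add_mod, Nat.mod_eq_of_lt ho, Nat.add_zero]
          · exact g3 a (by have : a ≠ j * m + o := fun h => hao ⟨rfl, h⟩
                           omega)
      have hmul : (s''.setReg 12 o).arr 1 j = j * m := (hP'.multiple_lt hj ho).1
      have hj10 : (s''.setReg 12 o).reg 10 = j := by simp [g10]
      have ho12 : (s''.setReg 12 o).reg 12 = o := by simp
      have hga : (s''.setReg 12 o).arr 2 j = g j := congrFun g2 j
      simp only [run]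
      rw [eval_eq]
      simp only [eval, hj10, hga, hP'.objects]
      rw [hmul, ho12]
      by_cases hgm : g j = m
      · rw [if_pos (by simp [hgm])]
        refine fill _ ?_
        rw [AssignmentProblem.key, if_pos hgm]
        refine Finset.sum_congr rfl fun a ha => ?_
        rw [eval_bitExp (hP'.setReg (by omega) a)]
        · simp [eval, g10]
        · simpa [eval, g10] using hj
        · simpa [eval] using ha
        · simpa [eval] using ho
      · rw [if_neg (by simp [hgm])]
        refine fill _ ?_
        have := hg j hj
        rw [AssignmentProblem.key, if_neg hgm, eval_bitExp hP']
        · simp only [eval, hj10, ho12, hga]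
        · simpa [eval, g10] using hj
        · simpa [eval] using ho
        · simp only [eval, hj10, hga]
          omega
  rw [h.agents] at key
  intro i hi o ho
  rw [key.2.2 _ (block_index_lt hi ho), mul_comm, Nat.mul_add_div (by omega),
    Nat.div_eq_of_lt ho, Nat.mul_add_mod, Nat.mod_eq_of_lt ho, Nat.add_zero]

/-! ### Correctness of the auction -/

open Auction

variable {key : ℕ → ℕ → ℕ} {st : ℕ → ℕ}

/-- The data of the auction are in place. -/
structure Ready (n m : ℕ) (key : ℕ → ℕ → ℕ) (st : ℕ → ℕ) (s : State) : Prop where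
  agents : s.reg 1 = n
  objects : s.reg 2 = m
  succ_objects : s.reg 3 = m + 1
  keys : ∀ i < n, ∀ o < m, s.arr 3 (s.arr 1 i + o) = key i o
  strict : ∀ i < n, (if s.arr 2 i < m then 1 else 0) = st i

lemma Ready.congr {s s' : State} (h : Ready n m key st s) (hr : ∀ x < 5, s'.reg x = s.reg x)
    (ha : ∀ a < 4, s'.arr a = s.arr a) : Ready n m key st s' where
  agents := by rw [hr 1 (by omega), h.agents]
  objects := by rw [hr 2 (by omega), h.objects]
  succ_objects := by rw [hr 3 (by omega), h.succ_objects]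
  keys := by rw [ha 1 (by omega), ha 3 (by omega)]; exact h.keys
  strict := by rw [ha 2 (by omega)]; exact h.strict

lemma Ready.setReg {s : State} (h : Ready n m key st s) {x : ℕ} (hx : 5 ≤ x) (v : ℕ) :
    Ready n m key st (s.setReg x v) :=
  h.congr (fun y hy => by rw [State.setReg_reg, if_neg (by omega)]) fun _ _ => rfl

lemma eval_keyExp {s : State} (h : Ready n m key st s) {x : ℕ} (hi : s.reg 10 < n)
    (ho : s.reg x < m) : (keyExp x).eval s = key (s.reg 10) (s.reg x) :=
  h.keys _ hi _ ho

lemma eval_unmetExp {s : State} (h : Ready n m key st s) (hi : s.reg 10 < n)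
    (ho : s.reg 12 < m) :
    unmetExp.eval s = if key (s.reg 10) (s.reg 12) ≠ 0 ∧
      n * heldCard m key (s.arr 4) (s.reg 10) (key (s.reg 10) (s.reg 12)) <
        groupCard m key (s.reg 10) (key (s.reg 10) (s.reg 12)) + st (s.reg 10)
      then 1 else 0 := by
  -- the inner sum, of `n` equal terms, stands for a multiplication by `n`
  have e₁ : (sum 20 2 (sum 21 1 (and (eq (get 4 (reg 20)) (reg 10))
      (eq (keyExp 20) (keyExp 12))))).eval s =
      n * heldCard m key (s.arr 4) (s.reg 10) (key (s.reg 10) (s.reg 12)) := by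
    rw [heldCard, Finset.card_filter, Finset.mul_sum]
    simp only [eval_sum, h.objects]
    refine Finset.sum_congr rfl fun o' ho' => ?_
    have ho' := Finset.mem_range.1 ho'
    have h' : ∀ y, Ready n m key st ((s.setReg 20 o').setReg 21 y) := fun y =>
      (h.setReg (by omega) _).setReg (by omega) _
    have e : ∀ y, (and (eq (get 4 (reg 20)) (reg 10)) (eq (keyExp 20) (keyExp 12))).eval
        ((s.setReg 20 o').setReg 21 y) = if s.arr 4 o' = s.reg 10 ∧
          key (s.reg 10) o' = key (s.reg 10) (s.reg 12) then 1 else 0 := fun y => by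
      rw [eval_and, eval_eq, eval_eq, eval_keyExp (h' y) (by simpa using hi) (by simpa using ho'),
        eval_keyExp (h' y) (by simpa using hi) (by simpa using ho)]
      simp [eval]
    simp only [e, Finset.sum_const, Finset.card_range, smul_eq_mul, State.setReg_reg]
    simp [h.agents]
  have e₂ : (sum 20 2 (eq (keyExp 20) (keyExp 12))).eval s =
      groupCard m key (s.reg 10) (key (s.reg 10) (s.reg 12)) := by
    rw [groupCard, Finset.card_filter]
    simp only [eval_sum, h.objects]
    refine Finset.sum_congr rfl fun o' ho' => ?_
    have h' : Ready n m key st (s.setReg 20 o') := h.setReg (by omega) _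
    rw [eval_eq, eval_keyExp h' (by simpa using hi) (by simpa using ho'),
      eval_keyExp h' (by simpa using hi) (by simpa using ho)]
    simp
  have e₃ : (lt (get 2 (reg 10)) (reg 2)).eval s = st (s.reg 10) := by
    rw [eval_lt, ← h.strict _ hi, ← h.objects]
    rfl
  rw [unmetExp, eval_and, eval_keyExp h hi ho, eval_lt, e₁]
  simp only [eval_add, e₂, e₃]
  simp

lemma eval_bidsExp {s : State} (h : Ready n m key st s) (hi : s.reg 10 < n)
    (ho : s.reg 12 < m) :
    bidsExp.eval s ≠ 0 ↔ Bids n m key st (s.arr 4) (s.arr 5) (s.reg 10) (s.reg 12) := by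
  have e : (sum 20 2 (and (eq (keyExp 20) (keyExp 12))
      (lt (get 5 (reg 20)) (get 5 (reg 12))))).eval s = 0 ↔
      ∀ o' < m, key (s.reg 10) o' = key (s.reg 10) (s.reg 12) →
        s.arr 5 (s.reg 12) ≤ s.arr 5 o' := by
    simp only [eval_sum, h.objects, Finset.sum_eq_zero_iff, Finset.mem_range]
    refine forall_congr' fun o' => forall_congr' fun ho' => ?_
    have h' : Ready n m key st (s.setReg 20 o') := h.setReg (by omega) _
    rw [eval_and, eval_eq, eval_keyExp h' (by simpa using hi) (by simpa using ho'),
      eval_keyExp h' (by simpa using hi) (by simpa using ho), eval_lt]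
    simp [eval]
  rw [bidsExp, eval_and, eval_and, eval_unmetExp h hi ho, eval_eq,
    eval_lt]
  simp only [show (lit 0).eval s = 0 from rfl, e]
  simp only [eval, h.succ_objects, Bids]
  simp
  tauto

lemma run_bid {s : State} (h : Ready n m key st s) (hi : s.reg 10 < n) (ho : s.reg 12 < m)
    (hb : Bids n m key st (s.arr 4) (s.arr 5) (s.reg 10) (s.reg 12)) :
    (bid.run s).arr 4 = Function.update (s.arr 4) (s.reg 12) (s.reg 10) ∧
    (bid.run s).arr 5 = Function.update (s.arr 5) (s.reg 12) (s.arr 5 (s.reg 12) + 1) := by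
  rw [bid, BProg.run, if_pos ((eval_bidsExp h hi ho).2 hb)]
  simp [BProg.run, State.setArr, eval]

lemma run_bid_of_not {s : State} (h : Ready n m key st s) (hi : s.reg 10 < n)
    (ho : s.reg 12 < m)
    (hb : ¬ Bids n m key st (s.arr 4) (s.arr 5) (s.reg 10) (s.reg 12)) : bid.run s = s := by
  rw [bid, BProg.run, if_neg fun h' => hb ((eval_bidsExp h hi ho).1 h')]
  rfl

lemma Ready.run_bid {s : State} (h : Ready n m key st s) : Ready n m key st (bid.run s) := by
  have hS : bid.Scoped 7 30 := scoped_round.2.2.2.2.2.2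
  refine h.congr (fun x hx => run_reg_lt hS s (by omega)) fun a ha =>
    run_arr_of_not_stores ?_ s
  simp [bid, Stores]
  omega

/-- Nobody bids in the state `s`. -/
def Done (n m : ℕ) (key : ℕ → ℕ → ℕ) (st : ℕ → ℕ) (s : State) : Prop :=
  ∀ i < n, ∀ o < m, ¬ Bids n m key st (s.arr 4) (s.arr 5) i o

/-- The sum of all prices. -/
def priceSum (m : ℕ) (s : State) : ℕ := ∑ o ∈ Finset.range m, s.arr 5 o

/-- A round that started in the state `s₀` and has treated the pairs in `p` is now in the state
`s`: either there was a bid and prices have gone up, or nothing has changed and nobody has bid. -/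
def Progress (n m : ℕ) (key : ℕ → ℕ → ℕ) (st : ℕ → ℕ) (s₀ : State) (p : ℕ → ℕ → Prop)
    (s : State) : Prop :=
  Ready n m key st s ∧ Invariant n m key st (s.arr 4) (s.arr 5) ∧
  (priceSum m s₀ + 1 ≤ priceSum m s ∧ ¬ Done n m key st s₀ ∨
    s.arr 4 = s₀.arr 4 ∧ s.arr 5 = s₀.arr 5 ∧
      ∀ i o, p i o → ¬ Bids n m key st (s₀.arr 4) (s₀.arr 5) i o)

lemma Progress.setReg {s₀ s : State} {p : ℕ → ℕ → Prop} (h : Progress n m key st s₀ p s) {x : ℕ}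
    (hx : 5 ≤ x) (v : ℕ) : Progress n m key st s₀ p (s.setReg x v) :=
  ⟨h.1.setReg hx v, h.2⟩

lemma Progress.mono {s₀ s : State} {p q : ℕ → ℕ → Prop} (h : Progress n m key st s₀ p s)
    (hq : ∀ i o, q i o → p i o) : Progress n m key st s₀ q s := by
  refine ⟨h.1, h.2.1, h.2.2.imp id fun h => ⟨h.1, h.2.1, fun i o hio => h.2.2 i o (hq i o hio)⟩⟩

lemma Progress.run_bid {s₀ s : State} {p : ℕ → ℕ → Prop} (h : Progress n m key st s₀ p s)
    (hi : s.reg 10 < n) (ho : s.reg 12 < m) :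
    Progress n m key st s₀ (fun i o => p i o ∨ i = s.reg 10 ∧ o = s.reg 12) (bid.run s) := by
  obtain ⟨h1, h2, h3⟩ := h
  by_cases hb : Bids n m key st (s.arr 4) (s.arr 5) (s.reg 10) (s.reg 12)
  · obtain ⟨r4, r5⟩ := WeakSDProgram.run_bid h1 hi ho hb
    refine ⟨h1.run_bid, ?_, Or.inl ?_⟩
    · rw [r4, r5]
      exact h2.bid hi ho hb
    · have hlt : priceSum m s + 1 ≤ priceSum m (bid.run s) := by
        refine Nat.succ_le_of_lt (Finset.sum_lt_sum (fun o _ => ?_)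
          ⟨s.reg 12, Finset.mem_range.2 ho, ?_⟩)
        · rw [r5, Function.update_apply]
          split_ifs with h'
          · rw [h']
            omega
          · rfl
        · simp [r5]
      rcases h3 with ⟨h3, h4⟩ | ⟨h3, h4, h5⟩
      · exact ⟨by omega, h4⟩
      · refine ⟨?_, fun hd => hd _ hi _ ho (h3 ▸ h4 ▸ hb)⟩
        have : priceSum m s = priceSum m s₀ := by simp only [priceSum, h4]
        omega
  · rw [run_bid_of_not h1 hi ho hb]
    refine ⟨h1, h2, h3.imp id ?_⟩
    rintro ⟨h3, h4, h5⟩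
    refine ⟨h3, h4, ?_⟩
    rintro i o (hio | ⟨rfl, rfl⟩)
    · exact h5 i o hio
    · exact h3 ▸ h4 ▸ hb

lemma run_round {s : State} (h : Ready n m key st s)
    (hI : Invariant n m key st (s.arr 4) (s.arr 5)) :
    Progress n m key st s (fun i o => i < n ∧ o < m) (round.run s) := by
  have main := run_loop_induction (x := 10) (r := 1) (s := s) (c := .loop 12 2 bid)
    (fun j s' => Progress n m key st s (fun i o => i < j ∧ o < m) s')
    ⟨h, hI, Or.inr ⟨rfl, rfl, fun i o hio => absurd hio.1 (Nat.not_lt_zero i)⟩⟩ ?_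
  · rw [h.agents] at main
    exact main
  rintro j s' hj hP
  rw [h.agents] at hj
  have hm : (s'.setReg 10 j).reg 2 = m := (hP.1.setReg (by omega) _).objects
  have inner := run_loop_induction (x := 12) (r := 2) (s := s'.setReg 10 j) (c := bid)
    (fun k s'' => Progress n m key st s (fun i o => i < j ∧ o < m ∨ i = j ∧ o < k) s'' ∧
      s''.reg 10 = j) ⟨(hP.setReg (by omega) _).mono fun i o hio => by omega, by simp⟩ ?_
  · rw [hm] at inner
    exact inner.1.mono fun i o hio => by omega
  · rintro o s'' ho ⟨hP', h10⟩
    rw [hm] at ho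
    have hb := (hP'.setReg (x := 12) (by omega) o).run_bid (by simpa [h10] using hj)
      (by simpa using ho)
    refine ⟨hb.mono fun a b hab => ?_, ?_⟩
    · simp only [State.setReg_reg, h10]
      simp
      omega
    · rw [run_reg_of_not_writes (by simp [bid, Writes])]
      simpa using h10

/-- After all rounds, nobody bids any more: as long as somebody does, every round raises the sum
of the prices, and this sum is at most `m * (m + 1)`. -/
lemma run_rounds {s : State} (h : Ready n m key st s)
    (hI : Invariant n m key st (s.arr 4) (s.arr 5)) (hT : s.reg 5 = m * (m + 1) + 1) :
    Ready n m key st ((loop 13 5 round).run s) ∧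
      Invariant n m key st (((loop 13 5 round).run s).arr 4) (((loop 13 5 round).run s).arr 5) ∧
      Done n m key st ((loop 13 5 round).run s) := by
  have main := run_loop_induction (x := 13) (r := 5) (s := s) (c := round)
    (fun t s' => Ready n m key st s' ∧ Invariant n m key st (s'.arr 4) (s'.arr 5) ∧
      (t ≤ priceSum m s' ∨ Done n m key st s')) ⟨h, hI, Or.inl (Nat.zero_le _)⟩ ?_
  · refine ⟨main.1, main.2.1, main.2.2.resolve_left fun hle => ?_⟩
    rw [hT] at hle
    have := Finset.sum_le_card_nsmul (Finset.range m) _ (m + 1)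
      fun o ho => main.2.1.price_le o (Finset.mem_range.1 ho)
    rw [Finset.card_range, smul_eq_mul] at this
    exact absurd (hle.trans this) (by omega)
  · rintro t s' - ⟨h1, h2, h3⟩
    obtain ⟨g1, g2, g3⟩ := run_round (h1.setReg (x := 13) (by omega) t) h2
    refine ⟨g1, g2, ?_⟩
    rcases g3 with ⟨g3, g4⟩ | ⟨g3, g4, g5⟩
    · exact Or.inl ((Nat.succ_le_succ (h3.resolve_right g4)).trans g3)
    · refine Or.inr fun i hi o ho => ?_
      rw [g3, g4]
      exact g5 i o ⟨hi, ho⟩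

lemma run_reset {s : State} (h : Ready n m key st s) :
    Ready n m key st (reset.run s) ∧
      Invariant n m key st ((reset.run s).arr 4) ((reset.run s).arr 5) := by
  have main := run_loop_induction (x := 12) (r := 2) (s := s)
    (c := .seq (.store 4 (reg 12) (reg 1)) (.store 5 (reg 12) (lit 0)))
    (fun j s' => Ready n m key st s' ∧ ∀ o < j, s'.arr 4 o = n ∧ s'.arr 5 o = 0)
    ⟨h, fun o ho => absurd ho (Nat.not_lt_zero o)⟩ ?_
  · rw [h.objects] at main
    exact ⟨main.1, invariant_init.congr (fun o ho => (main.2 o ho).1.symm)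
      fun o ho => (main.2 o ho).2.symm⟩
  · rintro j s' - ⟨h1, h2⟩
    refine ⟨(h1.setReg (x := 12) (by omega) j).congr (fun _ _ => rfl) fun a ha => ?_,
      fun o ho => ?_⟩
    · simp only [BProg.run]
      rw [State.setArr_arr_of_ne _ _ _ _ (by omega), State.setArr_arr_of_ne _ _ _ _ (by omega)]
    · simp [BProg.run, eval, h1.agents]
      by_cases hoj : o = j
      · simp [hoj]
      · simpa [hoj] using h2 o (by omega)

lemma run_test {s : State} (h : Ready n m key st s) [Decidable (Satisfies n m key st (s.arr 4))] :
    (test.run s).reg 7 = if Satisfies n m key st (s.arr 4) then 1 else s.reg 7 := by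
  have e : (sum 10 1 (sum 12 2 unmetExp)).eval s = 0 ↔ Satisfies n m key st (s.arr 4) := by
    simp only [eval_sum, Finset.sum_eq_zero_iff, Finset.mem_range, h.agents, State.setReg_reg,
      Satisfies]
    refine forall_congr' fun i => forall_congr' fun hi => ?_
    rw [if_neg (by omega), h.objects]
    refine forall_congr' fun o => forall_congr' fun ho => ?_
    rw [eval_unmetExp ((h.setReg (by omega) i).setReg (by omega) o) (by simpa using hi)
      (by simpa using ho)]
    simp
  rw [test, BProg.run]
  by_cases hS : Satisfies n m key st (s.arr 4)
  · rw [if_neg (not_not.2 (e.2 hS)), if_pos hS]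
    simp [BProg.run, eval]
  · rw [if_pos (mt e.1 hS), if_neg hS]
    rfl

/-! ### Correctness of the search -/

/-- The demands that belong to the guess `c` can be met. -/
def Feasible (A : AssignmentProblem n m) (c : ℕ) : Prop :=
  ∃ f, Satisfies n m (A.key (digit m c)) (AssignmentProblem.strictness m (digit m c)) f

open Classical in
lemma run_tryGuess {s : State} (h : Parsed A s) (hT : s.reg 5 = m * (m + 1) + 1)
    (hc : s.reg 8 < s.reg 6) :
    (tryGuess.run s).reg 7 = if Feasible A (s.reg 8) then 1 else s.reg 7 := by
  set c := s.reg 8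
  set s₁ := decode.run s with hs₁
  have d₁ : ∀ i < n, s₁.arr 2 i = digit m c i := run_decode h hc
  have P₁ : Parsed A s₁ := h.run (by omega) scoped_decode (by simp [decode, Stores])
    (by simp [decode, Stores])
  set s₂ := keys.run s₁ with hs₂
  have P₂ : Parsed A s₂ := P₁.run (by omega) scoped_keys (by simp [keys, Stores])
    (by simp [keys, Stores])
  have d₂ : s₂.arr 2 = s₁.arr 2 := run_arr_of_not_stores (by simp [keys, Stores]) _
  have R₂ : Ready n m (A.key (digit m c)) (AssignmentProblem.strictness m (digit m c)) s₂ := by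
    refine ⟨P₂.agents, P₂.objects, P₂.succ_objects, fun i hi o ho => ?_, fun i hi => ?_⟩
    · rw [(P₂.multiple_lt hi ho).1,
        run_keys P₁ (fun i hi => (d₁ i hi).trans_le (digit_le m c i)) i hi o ho]
      simp only [AssignmentProblem.key, d₁ i hi]
    · simp only [d₂, d₁ i hi, AssignmentProblem.strictness]
  obtain ⟨R₃, I₃⟩ := run_reset R₂
  set s₃ := reset.run s₂ with hs₃
  have T₃ : s₃.reg 5 = m * (m + 1) + 1 := by
    rw [hs₃, run_reg_lt scoped_reset _ (by omega), hs₂, run_reg_lt scoped_keys _ (by omega),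
      hs₁, run_reg_lt scoped_decode _ (by omega), hT]
  obtain ⟨R₄, I₄, D₄⟩ := run_rounds R₃ I₃ T₃
  have f₄ : ((loop 13 5 round).run s₃).reg 7 = s.reg 7 := by
    rw [run_reg_of_not_writes (by simp [round, bid, Writes]), hs₃,
      run_reg_of_not_writes (by simp [reset, Writes]), hs₂,
      run_reg_of_not_writes (by simp [keys, Writes]), hs₁,
      run_reg_of_not_writes (by simp [decode, Writes])]
  change (test.run ((loop 13 5 round).run s₃)).reg 7 = _
  rw [run_test R₄, f₄]
  refine if_congr ⟨fun hS => ⟨_, hS⟩, fun ⟨f, hf⟩ => ?_⟩ rfl rfl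
  by_contra hS
  exact I₄.not_satisfies D₄ hS f hf

open Classical in
lemma run_search {s : State} (h : Parsed A s) (hT : s.reg 5 = m * (m + 1) + 1)
    (h7 : s.reg 7 = 0) :
    (search.run s).reg 7 = if ∃ c < s.reg 6, Feasible A c then 1 else 0 := by
  have hstores : ∀ a < 2, ¬ tryGuess.Stores a := fun a ha => by
    simp [tryGuess, decode, keys, reset, round, bid, test, Stores]
    omega
  have main := run_loop_induction (x := 8) (r := 6) (s := s) (c := tryGuess)
    (fun j s' => Parsed A s' ∧ s'.reg 5 = m * (m + 1) + 1 ∧ s'.reg 6 = s.reg 6 ∧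
      s'.reg 7 = if ∃ c < j, Feasible A c then 1 else 0) ⟨h, hT, rfl, by simp [h7]⟩ ?_
  · exact main.2.2.2
  · rintro j s' hj ⟨h1, h2, h3, h4⟩
    have hP : Parsed A (s'.setReg 8 j) := h1.setReg (by omega) j
    refine ⟨hP.run (by omega) scoped_tryGuess (hstores 0 (by omega)) (hstores 1 (by omega)), ?_,
      ?_, ?_⟩
    · rw [run_reg_lt scoped_tryGuess _ (by omega)]
      simpa using h2
    · rw [run_reg_lt scoped_tryGuess _ (by omega)]
      simpa using h3
    · rw [run_tryGuess hP (by simpa using h2) (by simpa [h3] using hj)]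
      simp only [State.setReg_reg, h4, if_pos, Nat.exists_lt_succ_right]
      by_cases hj : Feasible A j
      · simp [hj]
      · simp [hj]

/-! ### Correctness of the program, and its running time -/

lemma run_parse (A : AssignmentProblem n m) :
    Parsed A (parse.run (init A.encode)) ∧ (parse.run (init A.encode)).reg 7 = 0 ∧
      (parse.run (init A.encode)).reg 0 = A.encode.length := by
  set s := init A.encode with hs
  set L := n + m + 2 + n * m ^ 2 with hL
  have h0 : s.reg 0 = L := A.length_encode
  have hbit : ∀ k < n + m + 2, s.arr 0 k = if k = n ∨ k = n + 1 + m then 0 else 1 :=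
    A.init_encode_arr
  -- the first `0` of the input is at position `n`
  have e₁ : (sum 20 0 (eq (sum 21 0
      (and (lt (reg 21) (add (reg 20) (lit 1))) (eq (get 0 (reg 21)) (lit 0)))) (lit 0))).eval s
      = n := by
    simp [eval, h0]
    convert Finset.card_range n using 2
    ext x
    simp only [Finset.mem_filter, Finset.mem_range]
    constructor
    · rintro ⟨hx, h⟩
      by_contra hn
      exact @h n (by omega) (by omega) (by simp [hbit n (by omega)])
    · intro hx
      refine ⟨by omega, fun y hy hyx => ?_⟩
      rw [hbit y (by omega), if_neg (by omega)]
      omega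
  -- the second `0` is at position `n + 1 + m`
  have e₂ : (sum 20 0 (and (lt (reg 1) (reg 20)) (eq (sum 21 0
      (and (and (lt (reg 1) (reg 21)) (lt (reg 21) (add (reg 20) (lit 1))))
        (eq (get 0 (reg 21)) (lit 0)))) (lit 0)))).eval (s.setReg 1 n) = m := by
    simp [eval, h0]
    trans (Finset.Ioo n (n + 1 + m)).card
    · congr 1
      ext x
      simp only [Finset.mem_filter, Finset.mem_range, Finset.mem_Ioo]
      constructor
      · rintro ⟨hx, h1, h⟩
        refine ⟨h1, ?_⟩
        by_contra hn
        exact @h (n + 1 + m) (by omega) (by omega) (by omega)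
          (by simp [hbit (n + 1 + m) (by omega)])
      · rintro ⟨h1, h2⟩
        refine ⟨by omega, h1, fun y hy hny hyx => ?_⟩
        rw [hbit y (by omega), if_neg (by omega)]
        omega
    · rw [Nat.card_Ioo]
      omega
  set s₁ := (((s.setReg 1 n).setReg 2 m).setReg 3 (m + 1)).setReg 4 (n + m + 2) with hs₁
  have hrun : parse.run s = (loop 10 0 (.store 1 (add (reg 10) (lit 1))
      (add (get 1 (reg 10)) (reg 2)))).run s₁ := by
    simp only [parse, BProg.run, e₁, e₂]
    simp [eval, hs₁]
  have hmain := run_loop_induction (x := 10) (r := 0) (s := s₁)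
    (c := .store 1 (add (reg 10) (lit 1)) (add (get 1 (reg 10)) (reg 2)))
    (fun j s' => s'.reg 0 = L ∧ s'.reg 1 = n ∧ s'.reg 2 = m ∧ s'.reg 3 = m + 1 ∧
      s'.reg 4 = n + m + 2 ∧ s'.reg 7 = 0 ∧ s'.arr 0 = s.arr 0 ∧ ∀ k ≤ j, s'.arr 1 k = k * m) ?_ ?_
  · rw [← hrun, show s₁.reg 0 = L by simp [hs₁, h0]] at hmain
    obtain ⟨g0, g1, g2, g3, g4, g7, ga, gm⟩ := hmain
    refine ⟨⟨g1, g2, g3, g4, fun i hi a ha b hb => ?_, fun k hk => gm k ?_⟩, g7, ?_⟩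
    · rw [ga]
      exact A.init_encode_arr_bit hi ha hb
    · have : n * m ≤ n * m ^ 2 := Nat.mul_le_mul_left n (Nat.le_self_pow (by omega) m)
      omega
    · rw [g0, A.length_encode]
  · simp [hs₁, h0]
    simp [hs, init]
  · rintro j s' - ⟨g0, g1, g2, g3, g4, g7, ga, gm⟩
    refine ⟨by simpa [BProg.run] using g0, by simpa [BProg.run] using g1,
      by simpa [BProg.run] using g2, by simpa [BProg.run] using g3,
      by simpa [BProg.run] using g4, by simpa [BProg.run] using g7, ?_, fun k hk => ?_⟩
    · simp only [BProg.run]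
      rw [State.setArr_arr_of_ne _ _ _ _ (by omega)]
      exact ga
    · simp [BProg.run, eval, g2, gm j le_rfl]
      split_ifs with hkj
      · rw [hkj, Nat.succ_mul]
      · exact gm k (by omega)

lemma run_bounds {s : State} (h : Parsed A s) :
    Parsed A (bounds.run s) ∧ (bounds.run s).reg 5 = m * (m + 1) + 1 ∧
      (bounds.run s).reg 6 = (m + 1) ^ n := by
  refine ⟨h.run le_rfl scoped_bounds (by simp [bounds, Stores]) (by simp [bounds, Stores]), ?_⟩
  have hmain := run_loop_induction (x := 10) (r := 1)
    (s := (s.setReg 5 (m * (m + 1) + 1)).setReg 6 1) (c := .assign 6 (sum 20 3 (reg 6)))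
    (fun j s' => s'.reg 3 = m + 1 ∧ s'.reg 5 = m * (m + 1) + 1 ∧ s'.reg 6 = (m + 1) ^ j) ?_ ?_
  · have hrun : bounds.run s = (loop 10 1 (.assign 6 (sum 20 3 (reg 6)))).run
        ((s.setReg 5 (m * (m + 1) + 1)).setReg 6 1) := by
      simp only [bounds, BProg.run]
      simp [eval, h.objects, h.succ_objects]
    rw [hrun]
    simp only [State.setReg_reg] at hmain
    simp [h.agents] at hmain
    exact hmain.2
  · simp [h.succ_objects]
  · rintro j s' - ⟨g3, g5, g6⟩
    simp [BProg.run, eval, g3, g5, g6, pow_succ, mul_comm]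

lemma exists_feasible_iff (hn : n ≠ 0) :
    (∃ c < (m + 1) ^ n, Feasible A c) ↔ A.HasWeakSDProportionalDiscreteAssignment := by
  rw [A.hasWeakSDProportionalDiscreteAssignment_iff hn]
  constructor
  · rintro ⟨c, -, hf⟩
    exact ⟨digit m c, fun i _ => digit_le m c i, hf⟩
  · rintro ⟨g, hg, f, hf⟩
    obtain ⟨c, hc, hcg⟩ := exists_digit_eq n m g hg
    refine ⟨c, hc, f, fun i hi e he hk => ?_⟩
    have h1 : A.key (digit m c) i = A.key g i := by
      funext o
      simp only [AssignmentProblem.key, hcg i hi]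
    have h2 : AssignmentProblem.strictness m (digit m c) i =
        AssignmentProblem.strictness m g i := by
      simp only [AssignmentProblem.strictness, hcg i hi]
    have := hf i hi e he (by rwa [h1] at hk)
    simpa only [Auction.groupCard, Auction.heldCard, h1, h2] using this

/-- A bound on the running time of the program for `n` agents, in terms of the length of the
input. All bounds of loops and sums are at most `(X + 2) ^ (n + 2)`. -/
noncomputable def timeBound (n : ℕ) : Polynomial ℕ :=
  (parse.time + bounds.time + search.time).comp ((Polynomial.X + 2) ^ (n + 2)) + 10

open Classical in
theorem program_answersWithin (A : AssignmentProblem n m) :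
    program.AnswersWithin A.encode A.HasWeakSDProportionalDiscreteAssignment
      ((timeBound n).eval A.encode.length) := by
  set L := A.encode.length with hL
  have hLe : L = n + m + 2 + n * m ^ 2 := A.length_encode
  set B := (L + 2) ^ (n + 2) with hB
  have hB2 : (L + 2) ^ 2 ≤ B := Nat.pow_le_pow_right (by omega) (by omega)
  have hLB : (L + 2) * 2 ≤ B := le_trans (by rw [sq]; exact Nat.mul_le_mul_left _ (by omega)) hB2
  have hTB : m * (m + 1) + 1 ≤ B := by
    have : m * (m + 1) ≤ (L + 1) * (L + 2) := Nat.mul_le_mul (by omega) (by omega)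
    have h2 : (L + 2) ^ 2 = (L + 1) * (L + 2) + (L + 2) := by ring
    omega
  have hGB : (m + 1) ^ n ≤ B :=
    (Nat.pow_le_pow_left (by omega) n).trans (Nat.pow_le_pow_right (by omega) (by omega))
  obtain ⟨P₁, z₁, l₁⟩ := run_parse A
  set s₁ := parse.run (init A.encode) with hs₁
  obtain ⟨P₂, T₂, G₂⟩ := run_bounds P₁
  set s₂ := bounds.run s₁ with hs₂
  have l₂ : s₂.reg 0 = L := by rw [hs₂, run_reg_lt scoped_bounds _ (by omega), l₁]
  have z₂ : s₂.reg 7 = 0 := by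
    rw [hs₂, run_reg_of_not_writes (by simp [bounds, Writes]), z₁]
  have F := run_search P₂ T₂ z₂
  set s₃ := search.run s₂ with hs₃
  have n₃ : s₃.reg 1 = n := by rw [hs₃, run_reg_lt scoped_search _ (by omega), P₂.agents]
  have m₃ : s₃.reg 2 = m := by rw [hs₃, run_reg_lt scoped_search _ (by omega), P₂.objects]
  obtain ⟨t₁, σ₁, ht₁, E₁, A₁, -⟩ := exec_compile (B := B) (by omega) scoped_parse
    (d := 30) le_rfl (s := init A.encode) (σ := init A.encode) ⟨fun _ _ => rfl, rfl⟩
    fun r hr => by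
      obtain rfl : r = 0 := by omega
      change L ≤ B
      omega
  obtain ⟨t₂, σ₂, ht₂, E₂, A₂, -⟩ := exec_compile (B := B) (by omega) scoped_bounds
    (d := 30) le_rfl A₁ fun r hr => by
      rw [← hs₁]
      interval_cases r
      · omega
      · rw [P₁.agents]; omega
      · rw [P₁.objects]; omega
      · rw [P₁.succ_objects]; omega
      · rw [P₁.offset]; omega
  obtain ⟨t₃, σ₃, ht₃, E₃, A₃, -⟩ := exec_compile (B := B) (by omega) scoped_search
    (d := 30) le_rfl A₂ fun r hr => by
      rw [← hs₁, ← hs₂]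
      interval_cases r
      · omega
      · rw [P₂.agents]; omega
      · rw [P₂.objects]; omega
      · rw [P₂.succ_objects]; omega
      · rw [P₂.offset]; omega
      · rw [T₂]; exact hTB
      · rw [G₂]; exact hGB
  have hval : (σ₃.setReg 0 ((Exp.sub (.reg 7) (.sub (.sub (.lit 1) (.reg 1))
      (.sub (.lit 1) (.reg 2)))).eval σ₃)).reg 0 =
      (if ∃ c < (m + 1) ^ n, Feasible A c then 1 else 0) - ((1 - n) - (1 - m)) := by
    have h7 : σ₃.reg 7 = if ∃ c < (m + 1) ^ n, Feasible A c then 1 else 0 := by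
      rw [A₃.1 7 (by omega), ← G₂]
      exact F
    have h1 : σ₃.reg 1 = n := (A₃.1 1 (by omega)).trans n₃
    have h2 : σ₃.reg 2 = m := (A₃.1 2 (by omega)).trans m₃
    simp only [Exp.eval, h7, h1, h2, State.setReg_reg, if_pos]
  have hans : (if ∃ c < (m + 1) ^ n, Feasible A c then 1 else 0) - ((1 - n) - (1 - m)) =
      if A.HasWeakSDProportionalDiscreteAssignment then 1 else 0 := by
    by_cases hn : n = 0
    · -- the only guess is feasible, for lack of demands
      rw [A.hasWeakSDProportionalDiscreteAssignment_iff_of_eq_zero hn, if_pos]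
      · split_ifs <;> omega
      · exact ⟨0, by positivity, fun _ => 0, fun i hi => by omega⟩
    · rw [show 1 - n - (1 - m) = 0 by omega, Nat.sub_zero]
      exact if_congr (exists_feasible_iff hn) rfl rfl
  refine ⟨_, _, ?_, Exec.andThen E₁ (Exec.andThen E₂ (Exec.andThen E₃ (Exec.assign' _ _ _))),
    fun h => ?_, fun h => ?_⟩
  · simp only [Exp.cost, timeBound, Polynomial.eval_add, Polynomial.eval_comp,
      Polynomial.eval_pow, Polynomial.eval_X, Polynomial.eval_ofNat, ← hB]
    omega
  · rw [hval, hans, if_pos h]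
  · rw [hval, hans, if_neg h]

end WeakSDProgram

/-- There is one algorithm which decides, for every assignment problem, whether a weak SD
proportional discrete assignment exists, and whose running time is, for every fixed number `n`
of agents, bounded by a polynomial in the size of the problem. -/
theorem mainTheorem3 :
    ∃ c : RAM.Prog, ∀ n : ℕ, ∃ P : Polynomial ℕ, ∀ (m : ℕ) (A : AssignmentProblem n m),
      c.AnswersWithin A.encode A.HasWeakSDProportionalDiscreteAssignment
        (P.eval A.encode.length) :=
  ⟨WeakSDProgram.program, fun n => ⟨WeakSDProgram.timeBound n, fun _ A =>
    WeakSDProgram.program_answersWithin A⟩⟩
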